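/- For $p\in\{2,3,4,\dots\}\cup\{\infty\}$ let $\Sigma_p=\varprojlim\{S^1\leftarrow S^1\leftarrow S^1\leftarrow\cdots\}$ be the solenoid, where all bonding maps are $z\mapsto z^p$ if $p<\infty$, and the successive bonding maps are $z\mapsto z^2,\ z\mapsto z^3,\ z\mapsto z^4,\dots$ if $p=\infty$. It is a compact abelian topological group, written additively. Let $K_p=\Sigma_p/(x\sim -x)$ with the quotient topology. For a metric space $X$ with base point $x_0$, a map $f:X\to\mathbb R$ is slowly oscillating if for every $r>0$ the diameter of $f(B(x,r))$ tends to $0$ as $d(x,x_0)\to\infty$. The Higson compactification $\bar X$ is the closure of the image of $X$ under the map $x\mapsto (f(x))_{f\in C_h}\in\prod_{f\in C_h}[\inf f,\sup f]$, where $C_h$ is the set of all bounded slowly oscillating continuous functions $f:X\to\mathbb R$. A map $f:Y\to Z$ is essential if every map homotopic to $f$ is surjective; a subset $S\subset\prod_{\alpha}Z_\alpha$ is essential if its projection to each factor $Z_\alpha$ is an essential map; an embedding into a product is essential if its image is. Theorem. Let $p\in\{2,3,4,\dots\}\cup\{\infty\}$. Then $K_p$ is a continuum (a nonempty compact connected metrizable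 space), and for every non-compact, simply connected, finite-dimensional (in the sense of covering dimension) proper geodesic metric space $X$ there are an index set $\mathcal A$ and an essential embedding of the Higson compactification $\bar X$ into the product $\prod_{\mathcal A}K_p$. Moreover, $K_2$ is homeomorphic to the Knaster (bucket handle) continuum, that is, to the union in the plane of all half circles in $\{y\ge 0\}$ with centre $(\tfrac12,0)$ and end points in the Cantor ternary set $C$, and, for $n\ge 1$, all half circles in $\{y\le 0\}$ with centre $(\tfrac{5}{2\cdot 3^n},0)$ and end points in $C\cap[\tfrac{2}{3^n},\tfrac{3}{3^n}]$. -/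

import Mathlib

open Set Filter Topology

universe u

/-- A map between metric spaces is slowly oscillating if for every `r > 0` the diameter of
`f (B(x, r))` tends to `0` as `x` tends to infinity. The filter `Bornology.cobounded X` is the
filter "`d(x, x₀) → ∞`", for any base point `x₀` of `X`. -/
def SlowlyOscillating {X Y : Type*} [MetricSpace X] [MetricSpace Y] (f : X → Y) : Prop :=
  ∀ r : ℝ, 0 < r →
    Tendsto (fun x : X => Metric.ediam (f '' Metric.ball x r)) (Bornology.cobounded X) (𝓝 0)

/-- The set `C_h` of bounded slowly oscillating continuous functions `X → ℝ`. -/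
def higsonFunctions (X : Type*) [MetricSpace X] : Set C(X, ℝ) :=
  {f | Bornology.IsBounded (range f) ∧ SlowlyOscillating f}

/-- The Higson compactification of `X`: the closure of the image of `X` under the evaluation map
`x ↦ (f x)_{f ∈ C_h}`. The image lies in the closed subset `∏ [inf f, sup f]` of `∏ ℝ`, so taking
the closure in `∏ ℝ` or in the product of intervals gives the same space. -/
abbrev HigsonCompactification (X : Type*) [MetricSpace X] : Type _ :=
  closure (range fun (x : X) (f : higsonFunctions X) => (f : C(X, ℝ)) x)

/-- A metric space is geodesic if any two points `x, y` are the ends of an isometric copy of the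
interval `[0, d(x, y)]`. -/
def IsGeodesicSpace (X : Type*) [MetricSpace X] : Prop :=
  ∀ x y : X, ∃ ξ : Icc (0 : ℝ) (dist x y) → X, Isometry ξ ∧
    ξ ⟨0, le_refl 0, dist_nonneg⟩ = x ∧ ξ ⟨dist x y, dist_nonneg, le_refl (dist x y)⟩ = y

/-- The covering dimension of `X` is at most `n`: every finite open cover has an open shrinking
no `n + 2` members of which have a common point. -/
def CoveringDimLE (X : Type*) [TopologicalSpace X] (n : ℕ) : Prop :=
  ∀ (k : ℕ) (U : Fin k → Set X), (∀ i, IsOpen (U i)) → ⋃ i, U i = univ →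
    ∃ V : Fin k → Set X, (∀ i, IsOpen (V i)) ∧ (∀ i, V i ⊆ U i) ∧ ⋃ i, V i = univ ∧
      ∀ s : Finset (Fin k), (⋂ i ∈ s, V i).Nonempty → s.card ≤ n + 1

/-- A space is finite dimensional if its covering dimension is finite. -/
def IsFiniteDimensionalSpace (X : Type*) [TopologicalSpace X] : Prop :=
  ∃ n : ℕ, CoveringDimLE X n

/-- The exponent of the bonding map from the `(k+1)`-st circle to the `k`-th one (`k = 0, 1, …`):
constantly `p` for finite `p`, and `2, 3, 4, …` for `p = ∞`. -/
def bondingExponent : ℕ∞ → ℕ → ℕ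
  | (p : ℕ), _ => p
  | ⊤, k => k + 2

/-- The solenoid `Σ_p`: the inverse limit of `S¹ ← S¹ ← S¹ ← ⋯` with the power maps
as bonding maps, a subgroup of `∏ S¹` with the subspace topology. For finite `p` this is the
`p`-adic solenoid and for `p = ∞` the adelic solenoid. The group is written multiplicatively. -/
def Solenoid (p : ℕ∞) : Subgroup (ℕ → Circle) where
  carrier := {z | ∀ k, z (k + 1) ^ bondingExponent p k = z k}
  mul_mem' := by
    intro a b ha hb k
    simp only [Pi.mul_apply, mul_pow, ha k, hb k]
  one_mem' := by
    intro k
    simp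
  inv_mem' := by
    intro a ha k
    simp only [Pi.inv_apply, inv_pow, ha k]

/-- The identification of each element of the solenoid with its group inverse. -/
def solenoidSetoid (p : ℕ∞) : Setoid (Solenoid p) where
  r x y := x = y ∨ x = y⁻¹
  iseqv :=
    { refl := fun _ => Or.inl rfl
      symm := by
        rintro x y (h | h)
        · exact Or.inl h.symm
        · exact Or.inr (by rw [h, inv_inv])
      trans := by
        rintro x y z (rfl | rfl) (rfl | rfl)
        · exact Or.inl rfl
        · exact Or.inr rfl
        · exact Or.inr rfl
        · exact Or.inl (inv_inv z) }

/-- The quotient space `K_p` of `Σ_p` by `x ∼ -x`, with the quotient topology. -/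
abbrev KContinuum (p : ℕ∞) : Type :=
  Quotient (solenoidSetoid p)

/-- A continuum: a nonempty compact connected metrizable space. -/
def IsContinuum (Z : Type*) [TopologicalSpace Z] : Prop :=
  CompactSpace Z ∧ ConnectedSpace Z ∧ TopologicalSpace.MetrizableSpace Z

/-- A map is essential if every map homotopic to it is surjective. -/
def IsEssentialMap {Y Z : Type*} [TopologicalSpace Y] [TopologicalSpace Z] (f : C(Y, Z)) : Prop :=
  ∀ g : C(Y, Z), f.Homotopic g → Function.Surjective g

/-- A subset of a product is essential if its projection on each factor is essential. -/
def IsEssentialSubset {A : Type*} {Z : A → Type*} [∀ a, TopologicalSpace (Z a)]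
    (S : Set (∀ a, Z a)) : Prop :=
  ∀ a : A, IsEssentialMap
    (⟨fun s : S => (s : ∀ a, Z a) a, (continuous_apply a).comp continuous_subtype_val⟩ : C(S, Z a))

/-- The Knaster (bucket handle) continuum in the plane: the union of the upper half circles with
centre `(1/2, 0)` ending at points of the Cantor ternary set, and, for `n = 1, 2, …`, the lower
half circles with centre `(5/(2·3ⁿ), 0)` ending at points of the Cantor set that lie in
`[2/3ⁿ, 3/3ⁿ]`. -/
def knasterContinuum : Set (ℝ × ℝ) :=
  {q | 0 ≤ q.2 ∧ ∃ c ∈ cantorSet, (q.1 - 1 / 2) ^ 2 + q.2 ^ 2 = (c - 1 / 2) ^ 2} ∪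
  {q | q.2 ≤ 0 ∧ ∃ n : ℕ, 1 ≤ n ∧ ∃ c ∈ cantorSet ∩ Icc (2 / 3 ^ n : ℝ) (3 / 3 ^ n),
    (q.1 - 5 / (2 * 3 ^ n)) ^ 2 + q.2 ^ 2 = (c - 5 / (2 * 3 ^ n)) ^ 2}

/-! Real parts of the circle coordinates embed `K_p` in a product of intervals. In these coordinates
the image of the one-parameter subgroup of the solenoid is `v ↦ (cos (v / d k))`, with `d k` the
degree of the projection from circle `k` to circle `0`; this line is dense. For a continuous slowly
oscillating `φ` all functions `cos (φ / d k)` lie in `C_h`, so `x ↦ line (φ x)` extends to the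
Higson compactification, with `cos φ` as coordinate `0` (`exists_lineExt`). Fix `φ = log (1 + dist x
x₀)` and use all `φ + b` with `b` in `C_h`: the functions `cos (φ + b)` separate points
(`eq_of_forall_cosFun_add`), which gives the embedding.

Each factor map is essential by a lifting argument. The height `d k * arccos (coord k)` has cosine
`coord 0` for every `k`, so by compactness a homotopy moves all heights by a bounded amount
(`exists_height_bound`). Since `φ + b` is unbounded on the connected space `X`, the heights of a
homotopic map still sweep intervals of length `2π * d n`, hence all values of coordinate `n`. As
coordinate `n` determines the earlier ones, the closed image is everything.

For `p = 2` the coordinates are the backward orbits of `y ↦ 2y² - 1`. A starting point and the signs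
of the later terms, coded by a point of the Cantor set `C`, present `K_2` as a quotient of `[-1, 1]
× C`. The bucket handle is another quotient: the segment over `c` goes to the upper and lower
quarter circles ending at `(c, 0)`. Both have the fibres described by `KnasterRel`. -/

/-! ### Degrees of the projections and the one-parameter subgroup -/

theorem two_le_bondingExponent {p : ℕ∞} (hp : 2 ≤ p) (k : ℕ) : 2 ≤ bondingExponent p k := by
  cases p with
  | top => exact Nat.le_add_left 2 k
  | coe n => exact Nat.cast_le.1 hp

/-- The degree of the projection from the `k`-th circle of the solenoid to the `0`-th one. -/
def solenoidDegree (p : ℕ∞) (k : ℕ) : ℕ := ∏ i ∈ Finset.range k, bondingExponent p i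

theorem solenoidDegree_zero (p : ℕ∞) : solenoidDegree p 0 = 1 := rfl

theorem solenoidDegree_succ (p : ℕ∞) (k : ℕ) :
    solenoidDegree p (k + 1) = solenoidDegree p k * bondingExponent p k :=
  Finset.prod_range_succ _ _

theorem two_pow_le_solenoidDegree {p : ℕ∞} (hp : 2 ≤ p) (k : ℕ) : 2 ^ k ≤ solenoidDegree p k := by
  induction k with
  | zero => simp [solenoidDegree_zero]
  | succ k ih =>
    rw [pow_succ, solenoidDegree_succ]
    exact Nat.mul_le_mul ih (two_le_bondingExponent hp k)

theorem solenoidDegree_pos {p : ℕ∞} (hp : 2 ≤ p) (k : ℕ) : (0 : ℝ) < solenoidDegree p k := by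
  have := two_pow_le_solenoidDegree hp k
  have h2 : 0 < 2 ^ k := by positivity
  exact_mod_cast h2.trans_le this

theorem tendsto_solenoidDegree {p : ℕ∞} (hp : 2 ≤ p) :
    Tendsto (fun k => (solenoidDegree p k : ℝ)) atTop atTop := by
  refine tendsto_atTop_mono (fun k => ?_)
    (tendsto_pow_atTop_atTop_of_one_lt (one_lt_two : (1 : ℝ) < 2))
  exact_mod_cast two_pow_le_solenoidDegree hp k

/-- The standard one-parameter subgroup of the solenoid. -/
noncomputable def solenoidLine {p : ℕ∞} (hp : 2 ≤ p) (v : ℝ) : Solenoid p :=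
  ⟨fun k => Circle.exp (v / solenoidDegree p k), fun k => by
    rw [← Circle.exp_natCast_mul, solenoidDegree_succ]
    have h1 := (solenoidDegree_pos hp k).ne'
    have h2 : (bondingExponent p k : ℝ) ≠ 0 := by
      have := two_le_bondingExponent hp k
      positivity
    congr 1
    push_cast
    field_simp⟩

theorem Solenoid.exists_pow_eq {p : ℕ∞} {k m : ℕ} (h : k ≤ m) :
    ∃ n : ℕ, solenoidDegree p m = n * solenoidDegree p k ∧
      ∀ z : Solenoid p, (z : ℕ → Circle) m ^ n = (z : ℕ → Circle) k := by
  induction m, h using Nat.le_induction with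
  | base => exact ⟨1, by simp⟩
  | succ m _ ih =>
    obtain ⟨n, hn, hz⟩ := ih
    refine ⟨bondingExponent p m * n, by rw [solenoidDegree_succ, hn]; ring, fun z => ?_⟩
    rw [pow_mul, z.2 m, hz z]

/-! ### Real parts on the circle -/

theorem Circle.exp_re (s : ℝ) : ((Circle.exp s : Circle) : ℂ).re = Real.cos s := by
  rw [Circle.coe_exp, Complex.exp_ofReal_mul_I_re]

/-- This is the Chebyshev identity: the real part of a power depends only on the real part. It lets
each coordinate of `K_p` determine the earlier ones. -/
theorem Circle.re_pow_eq_cos (z : Circle) (n : ℕ) :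
    ((z ^ n : Circle) : ℂ).re = Real.cos (n * Real.arccos (z : ℂ).re) := by
  obtain ⟨t, rfl⟩ : ∃ t : ℝ, z = Circle.exp t := ⟨_, (Circle.exp_arg z).symm⟩
  have h := Polynomial.Chebyshev.T_real_cos (Real.arccos (Real.cos t)) n
  rw [Real.cos_arccos (Real.neg_one_le_cos _) (Real.cos_le_one _),
    Polynomial.Chebyshev.T_real_cos] at h
  rw [← Circle.exp_natCast_mul, Circle.exp_re, Circle.exp_re]
  exact_mod_cast h

theorem Circle.re_mem_Icc (z : Circle) : (z : ℂ).re ∈ Icc (-1 : ℝ) 1 := by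
  have := Complex.abs_re_le_norm (z : ℂ)
  rw [Circle.norm_coe] at this
  exact abs_le.1 this

theorem Circle.eq_or_eq_inv_of_re_eq {z w : Circle} (h : (z : ℂ).re = (w : ℂ).re) :
    z = w ∨ z = w⁻¹ := by
  have hz := Circle.normSq_coe z
  have hw := Circle.normSq_coe w
  rw [Complex.normSq_apply] at hz hw
  have : (z : ℂ).im * (z : ℂ).im = (w : ℂ).im * (w : ℂ).im := by rw [h] at hz; linarith
  rcases mul_self_eq_mul_self_iff.1 this with h' | h'
  · exact Or.inl (Circle.ext (Complex.ext h h'))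
  · refine Or.inr (Circle.ext ?_)
    rw [Circle.coe_inv_eq_conj]
    exact Complex.ext (by simpa using h) (by simpa using h')

theorem Circle.re_inv (z : Circle) : ((z⁻¹ : Circle) : ℂ).re = (z : ℂ).re := by
  rw [Circle.coe_inv_eq_conj, Complex.conj_re]

/-! ### The embedding of `K_p` by real parts, and the dense line -/

namespace KContinuum

/-- The coordinates of the embedding of `K_p` into `∏ ℝ` induced by the real parts. -/
def coord {p : ℕ∞} : KContinuum p → ℕ → ℝ :=
  Quotient.lift (fun (z : Solenoid p) k => ((z : ℕ → Circle) k : ℂ).re) <| by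
    rintro a b (rfl | rfl)
    · rfl
    · funext k
      exact Circle.re_inv _

/-- The image in `K_p` of the standard one-parameter subgroup of the solenoid. -/
noncomputable def line {p : ℕ∞} (hp : 2 ≤ p) (v : ℝ) : KContinuum p :=
  Quotient.mk _ (solenoidLine hp v)

variable {p : ℕ∞}

theorem coord_mk (z : Solenoid p) (k : ℕ) :
    coord (Quotient.mk _ z) k = ((z : ℕ → Circle) k : ℂ).re := rfl

theorem coord_line (hp : 2 ≤ p) (v : ℝ) (k : ℕ) :
    coord (line hp v) k = Real.cos (v / solenoidDegree p k) := Circle.exp_re _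

theorem coord_mem_Icc (w : KContinuum p) (k : ℕ) : coord w k ∈ Icc (-1 : ℝ) 1 := by
  induction w using Quotient.inductionOn with
  | h z => exact Circle.re_mem_Icc _

theorem coord_eq_cos (hp : 2 ≤ p) (w : KContinuum p) {k m : ℕ} (h : k ≤ m) :
    coord w k = Real.cos (solenoidDegree p m * Real.arccos (coord w m) / solenoidDegree p k) := by
  induction w using Quotient.inductionOn with
  | h z =>
    obtain ⟨n, hn, hz⟩ := Solenoid.exists_pow_eq (p := p) h
    rw [coord_mk, coord_mk, ← hz z, Circle.re_pow_eq_cos, hn]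
    have := (solenoidDegree_pos hp k).ne'
    congr 1
    push_cast
    field_simp

theorem coord_zero_eq_cos (hp : 2 ≤ p) (w : KContinuum p) (m : ℕ) :
    coord w 0 = Real.cos (solenoidDegree p m * Real.arccos (coord w m)) := by
  rw [coord_eq_cos hp w (Nat.zero_le m), solenoidDegree_zero]
  simp

theorem coord_eq_of_le (hp : 2 ≤ p) {v w : KContinuum p} {k m : ℕ} (h : k ≤ m)
    (he : coord v m = coord w m) : coord v k = coord w k := by
  rw [coord_eq_cos hp v h, coord_eq_cos hp w h, he]

/-- At each level `z` agrees with `w` or with `w⁻¹`, and agreement at a level passes down to all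
earlier ones. So if `z` and `w` differ at level `k`, they differ at every later level; there `z`
agrees with `w⁻¹`, and hence also below. -/
theorem coord_injective : Function.Injective (coord : KContinuum p → ℕ → ℝ) := by
  intro a b h
  induction a using Quotient.inductionOn with
  | h z =>
  induction b using Quotient.inductionOn with
  | h w =>
  have h' : ∀ k, (z : ℕ → Circle) k = (w : ℕ → Circle) k ∨
      (z : ℕ → Circle) k = ((w⁻¹ : Solenoid p) : ℕ → Circle) k := fun k =>
    Circle.eq_or_eq_inv_of_re_eq (congr_fun h k)
  have down : ∀ (w : Solenoid p) (k m : ℕ), k ≤ m →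
      (z : ℕ → Circle) m = (w : ℕ → Circle) m → (z : ℕ → Circle) k = (w : ℕ → Circle) k := by
    intro w k m hkm e
    obtain ⟨n, -, hn⟩ := Solenoid.exists_pow_eq (p := p) hkm
    rw [← hn z, ← hn w, e]
  apply Quotient.sound
  by_cases hz : z = w
  · exact Or.inl hz
  · right
    have : ∃ k, (z : ℕ → Circle) k ≠ (w : ℕ → Circle) k := by
      by_contra! hc
      exact hz (Subtype.ext (funext hc))
    obtain ⟨k, hk⟩ := this
    refine Subtype.ext (funext fun j => ?_)
    rcases le_total k j with hj | hj
    · exact (h' j).resolve_left fun e => hk (down w k j hj e)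
    · exact down w⁻¹ j k hj ((h' k).resolve_left hk)

theorem continuous_coord : Continuous (coord : KContinuum p → ℕ → ℝ) := by
  refine Continuous.quotient_lift ?_ _
  refine continuous_pi fun k => Complex.continuous_re.comp (continuous_subtype_val.comp ?_)
  exact (continuous_apply k).comp continuous_subtype_val

theorem isClosed_solenoid : IsClosed (Solenoid p : Set (ℕ → Circle)) := by
  have : (Solenoid p : Set (ℕ → Circle)) =
      ⋂ k, {z : ℕ → Circle | z (k + 1) ^ bondingExponent p k = z k} := by
    ext z
    simp only [mem_iInter]
    rfl
  rw [this]
  exact isClosed_iInter fun k =>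
    isClosed_eq ((continuous_apply _).pow _) (continuous_apply _)

instance : CompactSpace (Solenoid p) := isCompact_iff_compactSpace.1 isClosed_solenoid.isCompact

theorem isClosedEmbedding_coord : IsClosedEmbedding (coord : KContinuum p → ℕ → ℝ) :=
  continuous_coord.isClosedEmbedding coord_injective

instance : TopologicalSpace.MetrizableSpace (KContinuum p) :=
  isClosedEmbedding_coord.isEmbedding.metrizableSpace

theorem continuous_line (hp : 2 ≤ p) : Continuous (line hp) := by
  rw [isClosedEmbedding_coord.isEmbedding.continuous_iff]
  refine continuous_pi fun k => ?_
  simp only [Function.comp_def, coord_line]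
  fun_prop

/-- A sequence all of whose finite parts come from points of a closed set comes from
a point of that set. -/
theorem mem_image_coord_of_forall_le {B : Set (KContinuum p)} (hB : IsClosed B) {y : ℕ → ℝ}
    (h : ∀ n, ∃ b ∈ B, ∀ k ≤ n, coord b k = y k) : y ∈ coord '' B := by
  rw [← ((isClosedEmbedding_coord.isClosedMap _ hB).closure_eq)]
  choose b hb hk using h
  refine mem_closure_of_tendsto (f := fun n => coord (b n)) (b := atTop)
    (tendsto_pi_nhds.2 fun k => ?_) (Eventually.of_forall fun n => mem_image_of_mem _ (hb n))
  exact tendsto_const_nhds.congr' ((eventually_ge_atTop k).mono fun n hn => (hk n k hn).symm)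

theorem eq_univ_of_coord (hp : 2 ≤ p) {B : Set (KContinuum p)} (hB : IsClosed B)
    (h : ∀ (w : KContinuum p) (n : ℕ), ∃ b ∈ B, coord b n = coord w n) : B = univ := by
  refine eq_univ_of_forall fun w => ?_
  obtain ⟨b, hb, e⟩ := mem_image_coord_of_forall_le hB (y := coord w) fun n => by
    obtain ⟨b, hb, e⟩ := h w n
    exact ⟨b, hb, fun k hk => coord_eq_of_le hp hk e⟩
  exact coord_injective e ▸ hb

theorem denseRange_line (hp : 2 ≤ p) : DenseRange (line hp) := by
  rw [DenseRange, dense_iff_closure_eq]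
  refine eq_univ_of_coord hp isClosed_closure fun w n =>
    ⟨line hp (solenoidDegree p n * Real.arccos (coord w n)), subset_closure (mem_range_self _), ?_⟩
  rw [coord_line, ← coord_eq_cos hp w le_rfl]

theorem isContinuum (hp : 2 ≤ p) : IsContinuum (KContinuum p) := by
  refine ⟨inferInstance, ?_, inferInstance⟩
  have h : IsConnected (range (line hp)) := isConnected_range (continuous_line hp)
  rw [connectedSpace_iff_univ, ← (denseRange_line hp).closure_range]
  exact h.closure

end KContinuum

/-! ### Heights, homotopies and essential maps -/

theorem Real.exists_mem_Icc_cos_eq (a : ℝ) {y : ℝ} (hy : y ∈ Icc (-1 : ℝ) 1) :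
    ∃ θ ∈ Icc a (a + 2 * Real.pi), Real.cos θ = y := by
  have : y ∈ Real.cos '' Icc a (a + 2 * Real.pi) := by
    rw [Real.cos_periodic.image_Icc Real.two_pi_pos, Real.range_cos]
    exact hy
  exact this

/-- A continuous function on an interval changes by less than `2π` if its cosine
oscillates by less than `2`. -/
theorem abs_sub_lt_two_pi_of_cos {θ : ℝ → ℝ} {a b : ℝ} (hab : a ≤ b) (hθ : ContinuousOn θ (Icc a b))
    (h : ∀ s ∈ Icc a b, ∀ t ∈ Icc a b, Real.cos (θ s) - Real.cos (θ t) < 2) :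
    |θ b - θ a| < 2 * Real.pi := by
  by_contra! hc
  have : ∃ u, Icc u (u + 2 * Real.pi) ⊆ θ '' Icc a b := by
    rcases le_abs.1 hc with h1 | h1
    · exact ⟨θ a, (Icc_subset_Icc_right (by linarith)).trans (intermediate_value_Icc hab hθ)⟩
    · exact ⟨θ b, (Icc_subset_Icc_right (by linarith)).trans (intermediate_value_Icc' hab hθ)⟩
  obtain ⟨u, hu⟩ := this
  obtain ⟨v, hv, e1⟩ := Real.exists_mem_Icc_cos_eq u (y := 1) (by simp)
  obtain ⟨w, hw, e2⟩ := Real.exists_mem_Icc_cos_eq u (y := -1) (by simp)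
  obtain ⟨s, hs, rfl⟩ := hu hv
  obtain ⟨t, ht, rfl⟩ := hu hw
  have := h s hs t ht
  rw [e1, e2] at this
  norm_num at this

namespace KContinuum

variable {p : ℕ∞}

/-- The lift of `coord w k` to the line, scaled by the degree; on the image of the line it
stabilizes at the absolute value of the parameter. -/
noncomputable def height (w : KContinuum p) (k : ℕ) : ℝ :=
  solenoidDegree p k * Real.arccos (coord w k)

theorem continuous_height (k : ℕ) : Continuous fun w : KContinuum p => height w k :=
  continuous_const.mul
    (Real.continuous_arccos.comp ((continuous_apply k).comp continuous_coord))

/-- `arccos` inverts `cos` on `[0, π]`, so the height is exact as soon as the degree is large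
compared with `v`. -/
theorem height_eq_abs (hp : 2 ≤ p) {w : KContinuum p} {v : ℝ} {k : ℕ}
    (h : coord w k = Real.cos (v / solenoidDegree p k)) (hv : |v| ≤ Real.pi * solenoidDegree p k) :
    height w k = |v| := by
  have hP := solenoidDegree_pos hp k
  rw [height, h, ← Real.cos_abs, abs_div, abs_of_pos hP,
    Real.arccos_cos (by positivity) ((div_le_iff₀ hP).2 hv)]
  field_simp

theorem height_le_abs (hp : 2 ≤ p) {w : KContinuum p} {v : ℝ} {k : ℕ}
    (h : coord w k = Real.cos (v / solenoidDegree p k)) : height w k ≤ |v| := by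
  rcases le_total |v| (Real.pi * solenoidDegree p k) with hv | hv
  · exact (height_eq_abs hp h hv).le
  · have hP := solenoidDegree_pos hp k
    refine le_trans ?_ hv
    rw [height, mul_comm]
    exact mul_le_mul_of_nonneg_right (Real.arccos_le_pi _) hP.le

/-- Homotopies change the heights by a bounded amount. -/
theorem exists_height_bound (hp : 2 ≤ p) {Y : Type*} [TopologicalSpace Y] [CompactSpace Y]
    {f g : C(Y, KContinuum p)} (H : f.Homotopic g) :
    ∃ B : ℝ, ∀ y k, |height (g y) k - height (f y) k| ≤ B := by
  obtain ⟨H⟩ := H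
  let c : C(unitInterval × Y, ℝ) :=
    ⟨fun q => coord (H q) 0, (continuous_apply 0).comp (continuous_coord.comp H.continuous)⟩
  have huc : UniformContinuous c.curry :=
    CompactSpace.uniformContinuous_of_continuous c.curry.continuous
  -- On a time step shorter than `δ`, coordinate `0` oscillates by less than `2`, uniformly in `y`.
  -- It is the cosine of the height at every level, so the resulting bound does not depend on `k`.
  obtain ⟨δ, hδ, hc⟩ := Metric.uniformContinuous_iff.1 huc 2 two_pos
  obtain ⟨N, hN⟩ := exists_nat_one_div_lt hδ
  have key : ∀ i : ℕ, ∀ y k,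
      |height (H (projIcc 0 1 zero_le_one (i * (1 / ((N : ℝ) + 1))), y)) k - height (f y) k| ≤
        2 * Real.pi * i := by
    intro i y k
    induction i with
    | zero =>
      have : projIcc (0 : ℝ) 1 zero_le_one ((0 : ℕ) * (1 / ((N : ℝ) + 1))) = 0 := by
        rw [Nat.cast_zero, zero_mul, projIcc_left]; rfl
      rw [this, H.apply_zero]
      simp
    | succ i ih =>
      have hpos : (0 : ℝ) < 1 / ((N : ℝ) + 1) := by positivity
      have h := abs_sub_lt_two_pi_of_cos
        (θ := fun t => height (H (projIcc 0 1 zero_le_one t, y)) k)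
        (a := i * (1 / ((N : ℝ) + 1))) (b := (i + 1 : ℕ) * (1 / ((N : ℝ) + 1)))
        (by push_cast; nlinarith)
        (Continuous.continuousOn <| (continuous_height k).comp <| H.continuous.comp <|
          continuous_projIcc.prodMk continuous_const)
        (by
          intro s hs t ht
          have hst : dist (projIcc (0 : ℝ) 1 zero_le_one s) (projIcc (0 : ℝ) 1 zero_le_one t)
              < δ := by
            rw [Subtype.dist_eq, Real.dist_eq]
            refine (abs_projIcc_sub_projIcc _).trans_lt (lt_of_le_of_lt ?_ hN)
            rw [abs_le]
            obtain ⟨h1, h2⟩ := hs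
            obtain ⟨h3, h4⟩ := ht
            push_cast at h2 h4
            constructor <;> linarith
          have h1 := (ContinuousMap.dist_apply_le_dist y).trans_lt (hc hst)
          rw [Real.dist_eq] at h1
          have h2 := (abs_lt.1 h1).2
          simp only [height, ← coord_zero_eq_cos hp]
          exact h2)
      calc _ ≤ _ := abs_sub_le _ (height (H (projIcc 0 1 zero_le_one (i * (1 / ((N : ℝ) + 1))), y)) k) _
        _ ≤ 2 * Real.pi + 2 * Real.pi * i := add_le_add h.le ih
        _ = _ := by push_cast; ring
  refine ⟨2 * Real.pi * (N + 1 : ℕ), fun y k => ?_⟩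
  have h := key (N + 1) y k
  have e : projIcc (0 : ℝ) 1 zero_le_one ((N + 1 : ℕ) * (1 / ((N : ℝ) + 1))) = 1 := by
    have : (((N + 1 : ℕ) : ℝ)) * (1 / ((N : ℝ) + 1)) = 1 := by push_cast; field_simp
    rw [this, projIcc_right]; rfl
  rwa [e, H.apply_one] at h

/-- A map of a compact space into `K_p` is essential if along a connected space it runs
in the image of the line, with unbounded parameter. -/
theorem isEssentialMap_of_line (hp : 2 ≤ p) {X Y : Type*} [TopologicalSpace X] [ConnectedSpace X]
    [TopologicalSpace Y] [CompactSpace Y] (i : C(X, Y)) (f : C(Y, KContinuum p)) (φ : X → ℝ)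
    (hφ : ∀ x, f (i x) = line hp (φ x)) (hunb : ∀ M, ∃ x, M ≤ |φ x|) : IsEssentialMap f := by
  intro g hfg
  obtain ⟨B, hB⟩ := exists_height_bound hp hfg
  have hcf : ∀ x k, coord (f (i x)) k = Real.cos (φ x / solenoidDegree p k) := fun x k => by
    rw [hφ, coord_line]
  rw [← range_eq_univ]
  refine eq_univ_of_coord hp (isCompact_range g.continuous).isClosed fun w n => ?_
  have hPn := solenoidDegree_pos hp n
  obtain ⟨x₀⟩ := (inferInstance : Nonempty X)
  -- `a` bounds the height of `g (i x₀)` at every level. The target height `θ * d n` is sought in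
  -- `[a, a + 2π * d n]`, a full period for coordinate `n`.
  set a := |φ x₀| + B with ha
  obtain ⟨θ, hθ, hcos⟩ := Real.exists_mem_Icc_cos_eq (a / solenoidDegree p n) (coord_mem_Icc w n)
  obtain ⟨x₁, hx₁⟩ := hunb (a + 2 * Real.pi * solenoidDegree p n + B)
  -- The level `m` is so late that the height of `f (i x₁)` is exactly `|φ x₁|`; by the choice of
  -- `x₁` the height of `g (i x₁)` then lies beyond the target.
  obtain ⟨m, hm, hnm⟩ := (((tendsto_solenoidDegree hp).eventually_ge_atTop (|φ x₁| / Real.pi)).and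
    (eventually_ge_atTop n)).exists
  rw [div_le_iff₀' Real.pi_pos] at hm
  have h0 : height (g (i x₀)) m ≤ θ * solenoidDegree p n := by
    have h1 := height_le_abs hp (hcf x₀ m)
    have h2 := (abs_le.1 (hB (i x₀) m)).2
    have h3 := (div_le_iff₀ hPn).1 hθ.1
    linarith
  have h1 : θ * solenoidDegree p n ≤ height (g (i x₁)) m := by
    have h1 := height_eq_abs hp (hcf x₁ m) hm
    have h2 := (abs_le.1 (hB (i x₁) m)).1
    have h3 := mul_le_mul_of_nonneg_right hθ.2 hPn.le
    rw [add_mul, div_mul_cancel₀ _ hPn.ne'] at h3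
    linarith
  obtain ⟨x, hx⟩ := mem_range_of_exists_le_of_exists_ge
    ((continuous_height m).comp (g.continuous.comp i.continuous)) ⟨x₀, h0⟩ ⟨x₁, h1⟩
  refine ⟨g (i x), mem_range_self _, ?_⟩
  have hx' : height (g (i x)) m = θ * solenoidDegree p n := hx
  rw [← hcos, coord_eq_cos hp _ hnm, ← height, hx', mul_div_cancel_right₀ _ hPn.ne']

end KContinuum

/-! ### Slowly oscillating functions -/

section SlowlyOscillating

variable {X : Type*} [MetricSpace X]

theorem slowlyOscillating_iff {Y : Type*} [MetricSpace Y] {f : X → Y} :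
    SlowlyOscillating f ↔ ∀ r : ℝ, 0 < r → ∀ ε : ℝ, 0 < ε → ∀ᶠ x in Bornology.cobounded X,
      ∀ y ∈ Metric.ball x r, ∀ z ∈ Metric.ball x r, dist (f y) (f z) ≤ ε := by
  refine forall₂_congr fun r _ => ?_
  rw [ENNReal.tendsto_nhds_zero]
  have key : ∀ x (ε : ENNReal), Metric.ediam (f '' Metric.ball x r) ≤ ε ↔
      ∀ y ∈ Metric.ball x r, ∀ z ∈ Metric.ball x r, edist (f y) (f z) ≤ ε := fun x ε => by
    simp only [Metric.ediam_le_iff, forall_mem_image]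
  simp only [key]
  constructor
  · intro h ε hε
    filter_upwards [h (ENNReal.ofReal ε) (ENNReal.ofReal_pos.2 hε)] with x hx y hy z hz
    exact (edist_le_ofReal hε.le).1 (hx y hy z hz)
  · intro h ε hε
    rcases eq_or_ne ε ⊤ with rfl | htop
    · simp
    filter_upwards [h ε.toReal (ENNReal.toReal_pos hε.ne' htop)] with x hx y hy z hz
    rw [← ENNReal.ofReal_toReal htop]
    exact (edist_le_ofReal ENNReal.toReal_nonneg).2 (hx y hy z hz)

theorem SlowlyOscillating.add {f g : X → ℝ} (hf : SlowlyOscillating f) (hg : SlowlyOscillating g) :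
    SlowlyOscillating fun x => f x + g x := by
  rw [slowlyOscillating_iff] at *
  intro r hr ε hε
  filter_upwards [hf r hr (ε / 2) (half_pos hε), hg r hr (ε / 2) (half_pos hε)] with x h1 h2 y hy z hz
  have := dist_add_add_le (f y) (g y) (f z) (g z)
  linarith [h1 y hy z hz, h2 y hy z hz]

theorem SlowlyOscillating.lipschitz_comp {Y Z : Type*} [MetricSpace Y] [MetricSpace Z] {f : X → Y}
    (hf : SlowlyOscillating f) {K : NNReal} {φ : Y → Z} (hφ : LipschitzWith K φ) :
    SlowlyOscillating fun x => φ (f x) := by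
  rw [slowlyOscillating_iff] at *
  intro r hr ε hε
  have hK : (0 : ℝ) < K + 1 := by positivity
  filter_upwards [hf r hr (ε / (K + 1)) (by positivity)] with x h1 y hy z hz
  have h2 := h1 y hy z hz
  rw [le_div_iff₀ hK] at h2
  nlinarith [hφ.dist_le_mul (f y) (f z), @dist_nonneg _ _ (f y) (f z)]

theorem SlowlyOscillating.const_mul {f : X → ℝ} (hf : SlowlyOscillating f) (c : ℝ) :
    SlowlyOscillating fun x => c * f x :=
  hf.lipschitz_comp (φ := fun y => c * y) (LipschitzWith.of_dist_le' (K := |c|) fun y z => by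
    rw [Real.dist_eq, Real.dist_eq, ← mul_sub, abs_mul])

theorem lipschitzWith_cos : LipschitzWith 1 Real.cos :=
  lipschitzWith_of_nnnorm_deriv_le Real.differentiable_cos fun x => by
    rw [Real.deriv_cos, ← NNReal.coe_le_coe]
    simpa using Real.abs_sin_le_one x

theorem lipschitzWith_sin : LipschitzWith 1 Real.sin :=
  lipschitzWith_of_nnnorm_deriv_le Real.differentiable_sin fun x => by
    rw [Real.deriv_sin, ← NNReal.coe_le_coe]
    simpa using Real.abs_cos_le_one x

theorem slowlyOscillating_const (c : ℝ) : SlowlyOscillating fun _ : X => c :=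
  slowlyOscillating_iff.2 fun _ _ _ hε => Eventually.of_forall fun _ _ _ _ _ => by
    simpa using hε.le

theorem slowlyOscillating_log (x₀ : X) : SlowlyOscillating fun x => Real.log (1 + dist x x₀) := by
  rw [slowlyOscillating_iff]
  intro r hr ε hε
  -- Then every point of the ball has distance at least `2r/ε` from `x₀`, and `log u ≤ u - 1` bounds
  -- the difference of logarithms by `2r / (2r/ε) = ε`.
  filter_upwards [(Metric.tendsto_dist_right_cobounded_atTop x₀).eventually_ge_atTop (r + 2 * r / ε)]
    with x hx y hy z hz
  have key : ∀ y ∈ Metric.ball x r, ∀ z ∈ Metric.ball x r,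
      Real.log (1 + dist y x₀) - Real.log (1 + dist z x₀) ≤ ε := by
    intro y hy z hz
    rw [Metric.mem_ball] at hy hz
    have h1 : (0 : ℝ) < 1 + dist y x₀ := by positivity
    have h2 : (0 : ℝ) < 1 + dist z x₀ := by positivity
    have h3 := Real.log_le_sub_one_of_pos (div_pos h1 h2)
    rw [Real.log_div h1.ne' h2.ne'] at h3
    refine h3.trans ?_
    rw [sub_le_iff_le_add, div_le_iff₀ h2]
    have h4 : 2 * r / ε ≤ dist z x₀ := by
      have := dist_triangle x z x₀
      rw [dist_comm x z] at this
      linarith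
    rw [div_le_iff₀ hε] at h4
    have h5 := dist_triangle4_right y x₀ x z
    have h6 := dist_triangle y z x₀
    have h7 := dist_triangle_right y z x
    nlinarith
  rw [Real.dist_eq, abs_le]
  have := key y hy z hz
  have := key z hz y hy
  constructor <;> linarith

end SlowlyOscillating

/-! ### The Higson compactification and its essential embedding -/

namespace HigsonCompactification

variable {X : Type*} [MetricSpace X]

/-- The canonical map of a space into its Higson compactification. -/
def incl : C(X, HigsonCompactification X) :=
  ⟨fun x => ⟨fun f => (f : C(X, ℝ)) x, subset_closure (mem_range_self x)⟩,
    Continuous.subtype_mk (continuous_pi fun f : higsonFunctions X => (f : C(X, ℝ)).continuous) _⟩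

/-- The extension of a bounded slowly oscillating function to the Higson compactification. -/
def ext (h : higsonFunctions X) : C(HigsonCompactification X, ℝ) :=
  ⟨fun ξ => ξ.1 h, (continuous_apply h).comp continuous_subtype_val⟩

theorem denseRange_incl : DenseRange (incl : X → HigsonCompactification X) := by
  intro ξ
  rw [closure_subtype]
  convert ξ.2
  ext v
  simp [incl]

theorem ext_separates {ξ η : HigsonCompactification X} (h : ∀ f, ext f ξ = ext f η) : ξ = η :=
  Subtype.ext (funext h)

instance : CompactSpace (HigsonCompactification X) := by
  rw [← isCompact_iff_compactSpace]
  have hb : ∀ f : higsonFunctions X, ∃ C : ℝ, ∀ x, ‖(f : C(X, ℝ)) x‖ ≤ C := fun f => by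
    obtain ⟨C, hC⟩ := f.2.1.exists_norm_le
    exact ⟨C, fun x => hC _ (mem_range_self x)⟩
  choose C hC using hb
  refine (isCompact_univ_pi fun f => isCompact_Icc (a := -C f) (b := C f)).of_isClosed_subset
    isClosed_closure (closure_minimal ?_ (isClosed_set_pi fun f _ => isClosed_Icc))
  rintro _ ⟨x, rfl⟩ f -
  exact abs_le.1 (hC f x)

theorem mem_higsonFunctions_of_abs_le (f : C(X, ℝ)) (C : ℝ) (hC : ∀ x, |f x| ≤ C)
    (hf : SlowlyOscillating f) : f ∈ higsonFunctions X := by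
  refine ⟨(Metric.isBounded_Icc (-C) C).subset ?_, hf⟩
  rintro _ ⟨x, rfl⟩
  exact abs_le.1 (hC x)

/-- The cosine of a slowly oscillating function. -/
noncomputable def cosFun (φ : C(X, ℝ)) (hφ : SlowlyOscillating φ) : higsonFunctions X :=
  ⟨⟨fun x => Real.cos (φ x), Real.continuous_cos.comp φ.continuous⟩,
    mem_higsonFunctions_of_abs_le _ 1 (fun _ => Real.abs_cos_le_one _)
      (hφ.lipschitz_comp (φ := Real.cos) lipschitzWith_cos)⟩

/-- The sine of a slowly oscillating function. -/
noncomputable def sinFun (φ : C(X, ℝ)) (hφ : SlowlyOscillating φ) : higsonFunctions X :=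
  ⟨⟨fun x => Real.sin (φ x), Real.continuous_sin.comp φ.continuous⟩,
    mem_higsonFunctions_of_abs_le _ 1 (fun _ => Real.abs_sin_le_one _)
      (hφ.lipschitz_comp (φ := Real.sin) lipschitzWith_sin)⟩

/-- The function `c * b + d`. -/
noncomputable def affineFun (c d : ℝ) (b : higsonFunctions X) : higsonFunctions X :=
  ⟨⟨fun x => c * (b : C(X, ℝ)) x + d, by fun_prop⟩, by
    obtain ⟨C, hC⟩ := b.2.1.exists_norm_le
    refine mem_higsonFunctions_of_abs_le _ (|c| * C + |d|) (fun x => ?_)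
      ((b.2.2.const_mul c).add (slowlyOscillating_const d))
    refine (abs_add_le _ _).trans (add_le_add_left ?_ _)
    rw [abs_mul]
    exact mul_le_mul_of_nonneg_left (hC _ (mem_range_self x)) (abs_nonneg c)⟩

theorem ext_affineFun (c d : ℝ) (b : higsonFunctions X) (ξ : HigsonCompactification X) :
    ext (affineFun c d b) ξ = c * ext b ξ + d := by
  refine congr_fun (denseRange_incl.equalizer (g := ext (affineFun c d b))
    (h := fun ξ => c * ext b ξ + d) (by fun_prop) (by fun_prop) ?_) ξ
  funext x
  rfl

theorem ext_cosFun_add (φ : C(X, ℝ)) (hφ : SlowlyOscillating φ) (b : higsonFunctions X)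
    (ξ : HigsonCompactification X) :
    ext (cosFun (φ + (b : C(X, ℝ))) (hφ.add b.2.2)) ξ =
      ext (cosFun φ hφ) ξ * Real.cos (ext b ξ) - ext (sinFun φ hφ) ξ * Real.sin (ext b ξ) := by
  refine congr_fun (denseRange_incl.equalizer (g := ext (cosFun (φ + (b : C(X, ℝ))) (hφ.add b.2.2)))
    (h := fun ξ => ext (cosFun φ hφ) ξ * Real.cos (ext b ξ) -
      ext (sinFun φ hφ) ξ * Real.sin (ext b ξ)) (by fun_prop) (by fun_prop) ?_) ξ
  funext x
  exact Real.cos_add _ _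

theorem ext_cosFun_sq_add (φ : C(X, ℝ)) (hφ : SlowlyOscillating φ)
    (ξ : HigsonCompactification X) :
    ext (cosFun φ hφ) ξ ^ 2 + ext (sinFun φ hφ) ξ ^ 2 = 1 := by
  refine congr_fun (denseRange_incl.equalizer
    (g := fun ξ => ext (cosFun φ hφ) ξ ^ 2 + ext (sinFun φ hφ) ξ ^ 2)
    (h := fun _ => 1) (by fun_prop) (by fun_prop) ?_) ξ
  funext x
  exact Real.cos_sq_add_sin_sq _

/-- The functions `cos (φ + b)` with `b` bounded separate the points of the Higson
compactification. -/
theorem eq_of_forall_cosFun_add (φ : C(X, ℝ)) (hφ : SlowlyOscillating φ)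
    {ξ η : HigsonCompactification X} (h : ∀ b : higsonFunctions X,
      ext (cosFun (φ + (b : C(X, ℝ))) (hφ.add b.2.2)) ξ = ext (cosFun (φ + (b : C(X, ℝ))) (hφ.add b.2.2)) η) : ξ = η := by
  refine ext_separates fun b => ?_
  -- The hypothesis is available for every affine function of `b`, not only for `b` itself.
  have key : ∀ l d : ℝ,
      ext (cosFun φ hφ) ξ * Real.cos (l * ext b ξ + d) -
        ext (sinFun φ hφ) ξ * Real.sin (l * ext b ξ + d) =
      ext (cosFun φ hφ) η * Real.cos (l * ext b η + d) -
        ext (sinFun φ hφ) η * Real.sin (l * ext b η + d) := fun l d => by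
    have := h (affineFun l d b)
    rwa [ext_cosFun_add, ext_cosFun_add, ext_affineFun, ext_affineFun] at this
  -- Constant shifts `0` and `π/2` show that the extensions of `cos φ` and `sin φ` agree at `ξ` and
  -- `η`.
  have hc := key 0 0
  have hs := key 0 (Real.pi / 2)
  simp at hc hs
  have hsq := ext_cosFun_sq_add φ hφ ξ
  rw [← hc, ← hs] at key
  by_contra hne
  have hd : ext b ξ - ext b η ≠ 0 := sub_ne_zero.2 hne
  -- The scaling makes the two values of `b` differ by exactly `π`. Then the common values of `cos
  -- φ` and `sin φ` equal their own negatives, although their squares sum to `1`.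
  have h1 := key (Real.pi / (ext b ξ - ext b η)) (-(Real.pi / (ext b ξ - ext b η)) * ext b η)
  have h2 := key (Real.pi / (ext b ξ - ext b η))
    (-(Real.pi / (ext b ξ - ext b η)) * ext b η + Real.pi / 2)
  have e1 : Real.pi / (ext b ξ - ext b η) * ext b ξ + -(Real.pi / (ext b ξ - ext b η)) * ext b η
      = Real.pi := by field_simp; ring
  have e2 : Real.pi / (ext b ξ - ext b η) * ext b η + -(Real.pi / (ext b ξ - ext b η)) * ext b η
      = 0 := by ring
  rw [e1, e2] at h1
  rw [← add_assoc, ← add_assoc, e1, e2] at h2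
  simp [Real.cos_add, Real.sin_add] at h1 h2
  nlinarith

/-- The extension to the Higson compactification of the composition of a slowly oscillating
function with the line in `K_p`. -/
theorem exists_lineExt {p : ℕ∞} (hp : 2 ≤ p) (φ : C(X, ℝ)) (hφ : SlowlyOscillating φ) :
    ∃ f : C(HigsonCompactification X, KContinuum p),
      (∀ x, f (incl x) = KContinuum.line hp (φ x)) ∧
      ∀ ξ, KContinuum.coord (f ξ) 0 = ext (cosFun φ hφ) ξ := by
  let φk : ℕ → C(X, ℝ) := fun k => ⟨fun x => (solenoidDegree p k : ℝ)⁻¹ * φ x, by fun_prop⟩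
  have hφk : ∀ k, SlowlyOscillating (φk k) := fun k => hφ.const_mul _
  let s : HigsonCompactification X → ℕ → ℝ := fun ξ k => ext (cosFun (φk k) (hφk k)) ξ
  have hs : Continuous s := continuous_pi fun k => (ext _).continuous
  have hi : ∀ x, s (incl x) = KContinuum.coord (KContinuum.line hp (φ x)) := fun x => by
    funext k
    rw [KContinuum.coord_line, div_eq_inv_mul]
    rfl
  -- The image of `K_p` is closed and contains the values of `s` on the dense subset `X`.
  have hmem : ∀ ξ, s ξ ∈ range (KContinuum.coord (p := p)) := fun ξ =>
    denseRange_incl.induction_on (p := fun ξ => s ξ ∈ range (KContinuum.coord (p := p))) ξ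
      (KContinuum.isClosedEmbedding_coord.isClosed_range.preimage hs)
      fun x => by rw [hi]; exact mem_range_self _
  choose f hf using hmem
  refine ⟨⟨f, ?_⟩, fun x => KContinuum.coord_injective ?_, fun ξ => ?_⟩
  · rw [KContinuum.isClosedEmbedding_coord.isEmbedding.continuous_iff]
    exact hs.congr fun ξ => (hf ξ).symm
  · rw [← hi]; exact hf _
  · have h0 : φk 0 = φ := by
      ext x
      simp [φk, solenoidDegree_zero]
    have := congr_fun (hf ξ) 0
    simp only [s, h0] at this
    exact this

/-- The Higson compactification of an unbounded connected space has an essential embedding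
into a power of `K_p`. -/
theorem exists_essential_embedding {p : ℕ∞} (hp : 2 ≤ p) (X : Type u) [MetricSpace X]
    [ConnectedSpace X] (hX : (Bornology.cobounded X).NeBot) :
    ∃ (A : Type u) (F : HigsonCompactification X → (A → KContinuum p)),
      IsEmbedding F ∧ IsEssentialSubset (range F) := by
  obtain ⟨x₀⟩ := (inferInstance : Nonempty X)
  let φ : C(X, ℝ) := ⟨fun x => Real.log (1 + dist x x₀), by
    refine Continuous.log (by fun_prop) fun x => ?_
    positivity⟩
  have hφ : SlowlyOscillating φ := slowlyOscillating_log x₀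
  have ht : Tendsto φ (Bornology.cobounded X) atTop :=
    Real.tendsto_log_atTop.comp
      (tendsto_atTop_add_const_left _ _ (Metric.tendsto_dist_right_cobounded_atTop x₀))
  choose f hline hcoord using fun b : higsonFunctions X =>
    exists_lineExt hp (φ + (b : C(X, ℝ))) (hφ.add b.2.2)
  let F : HigsonCompactification X → (higsonFunctions X → KContinuum p) := fun ξ b => f b ξ
  have hF : Continuous F := continuous_pi fun b => (f b).continuous
  refine ⟨higsonFunctions X, F, (hF.isClosedEmbedding fun ξ η h => ?_).isEmbedding, fun b g hg => ?_⟩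
  · refine eq_of_forall_cosFun_add φ hφ fun b => ?_
    rw [← hcoord, ← hcoord]
    exact congr_arg (fun w => KContinuum.coord w 0) (congr_fun h b)
  · have hess : IsEssentialMap (f b) := by
      refine KContinuum.isEssentialMap_of_line hp incl (f b) _ (hline b) fun M => ?_
      obtain ⟨C, hC⟩ := b.2.1.exists_norm_le
      obtain ⟨x, hx⟩ := (ht.eventually_ge_atTop (M + C)).exists
      refine ⟨x, le_trans ?_ (le_abs_self _)⟩
      have := (abs_le.1 (hC _ (mem_range_self x))).1
      rw [ContinuousMap.add_apply]
      linarith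
    let F' : C(HigsonCompactification X, range F) := ⟨rangeFactorization F, hF.rangeFactorization⟩
    -- Precomposition with `F'` turns a homotopy of the projection of the image into a homotopy of
    -- `f b`.
    have h := hess (g.comp F') (hg.comp (.refl F'))
    exact Function.Surjective.of_comp (g := F') h

end HigsonCompactification

/-! ### Symmetries and bands of the Cantor set -/

section CantorSet

theorem one_sub_mem_preCantorSet (n : ℕ) : ∀ {c : ℝ}, c ∈ preCantorSet n → 1 - c ∈ preCantorSet n := by
  induction n with
  | zero =>
    intro c hc
    rw [preCantorSet_zero] at hc ⊢
    exact ⟨by linarith [hc.2], by linarith [hc.1]⟩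
  | succ n ih =>
    intro c hc
    rw [preCantorSet_succ] at hc ⊢
    rcases hc with ⟨x, hx, rfl⟩ | ⟨x, hx, rfl⟩
    · exact Or.inr ⟨1 - x, ih hx, by ring⟩
    · exact Or.inl ⟨1 - x, ih hx, by ring⟩

theorem one_sub_mem_cantorSet {c : ℝ} (hc : c ∈ cantorSet) : 1 - c ∈ cantorSet :=
  mem_iInter.2 fun n => one_sub_mem_preCantorSet n (mem_iInter.1 hc n)

theorem div_three_mem_cantorSet {c : ℝ} (hc : c ∈ cantorSet) : c / 3 ∈ cantorSet := by
  rw [cantorSet_eq_union_halves]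
  exact Or.inl ⟨c, hc, rfl⟩

/-- The last third is unfolded with a reflection, as by the tent map of slope `3`; this matches the
folding map `y ↦ 2y² - 1`. -/
theorem cantorSet_cases {c : ℝ} (hc : c ∈ cantorSet) :
    (c ≤ 1 / 3 ∧ 3 * c ∈ cantorSet) ∨ (2 / 3 ≤ c ∧ 3 * (1 - c) ∈ cantorSet) := by
  rw [cantorSet_eq_union_halves] at hc
  rcases hc with ⟨x, hx, rfl⟩ | ⟨x, hx, rfl⟩
  · have := cantorSet_subset_unitInterval hx
    refine Or.inl ⟨by linarith [this.2], ?_⟩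
    convert hx using 1
    ring
  · have := cantorSet_subset_unitInterval hx
    refine Or.inr ⟨by linarith [this.1], ?_⟩
    convert one_sub_mem_cantorSet hx using 1
    ring

theorem ne_half_of_mem_cantorSet {c : ℝ} (hc : c ∈ cantorSet) : c ≠ 1 / 2 := by
  rintro rfl
  rcases cantorSet_cases hc with h | h <;> norm_num at h

/-- The interval `[2/3ⁿ, 3/3ⁿ]`. -/
def cantorBand (n : ℕ) : Set ℝ := Icc (2 / 3 ^ n) (3 / 3 ^ n)

theorem mem_cantorBand_succ {n : ℕ} {c : ℝ} : c ∈ cantorBand (n + 1) ↔ 3 * c ∈ cantorBand n := by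
  have h : (0 : ℝ) < 3 ^ n := by positivity
  simp only [cantorBand, mem_Icc, pow_succ, div_le_iff₀ h, le_div_iff₀ h,
    div_le_iff₀ (mul_pos h three_pos), le_div_iff₀ (mul_pos h three_pos)]
  constructor <;> rintro ⟨h1, h2⟩ <;> constructor <;> linarith

theorem pos_of_mem_cantorBand {n : ℕ} {c : ℝ} (h : c ∈ cantorBand n) : 0 < c :=
  lt_of_lt_of_le (by positivity) h.1

theorem exists_mem_cantorBand {c : ℝ} (hc : c ∈ cantorSet) (h0 : c ≠ 0) :
    ∃ n, c ∈ cantorBand (n + 1) := by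
  obtain ⟨h1, h2⟩ := cantorSet_subset_unitInterval hc
  have hpos : 0 < c := lt_of_le_of_ne h1 (Ne.symm h0)
  obtain ⟨N, hN⟩ := pow_unbounded_of_one_lt (1 / c) (by norm_num : (1 : ℝ) < 3)
  rw [div_lt_iff₀ hpos] at hN
  clear h0 h1
  induction N generalizing c with
  | zero => linarith
  | succ N ih =>
    rcases cantorSet_cases hc with ⟨h3, h4⟩ | ⟨h3, -⟩
    · obtain ⟨n, hn⟩ := ih h4 (cantorSet_subset_unitInterval h4).2 (by linarith)
        (by rw [pow_succ] at hN; linarith)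
      exact ⟨n + 1, mem_cantorBand_succ.2 hn⟩
    · refine ⟨0, ?_, ?_⟩ <;> norm_num <;> linarith

/-- Band `n + 1` ends at `1 / 3 ^ n` and band `n - 1` begins at `6 / 3 ^ n`, so the open interval
between these points meets only band `n`. This bound and the next give uniqueness of the band and
local constancy of the centre. -/
theorem le_of_mem_cantorBand {n m : ℕ} {x : ℝ} (hx : x ∈ cantorBand m) (h : 1 / 3 ^ n < x) :
    m ≤ n := by
  by_contra! hlt
  have h1 : (3 : ℝ) ^ (n + 1) ≤ 3 ^ m := pow_le_pow_right₀ (by norm_num) hlt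
  have h2 := h.trans_le hx.2
  rw [div_lt_div_iff₀ (by positivity) (by positivity)] at h2
  rw [pow_succ] at h1
  linarith

theorem ge_of_mem_cantorBand {n m : ℕ} {x : ℝ} (hx : x ∈ cantorBand m) (h : x < 6 / 3 ^ n) :
    n ≤ m := by
  by_contra! hlt
  have h1 : (3 : ℝ) ^ (m + 1) ≤ 3 ^ n := pow_le_pow_right₀ (by norm_num) hlt
  have h2 := hx.1.trans_lt h
  rw [div_lt_div_iff₀ (by positivity) (by positivity)] at h2
  rw [pow_succ] at h1
  linarith

theorem cantorBand_subset_Ioo (n : ℕ) : cantorBand n ⊆ Ioo (1 / 3 ^ n) (6 / 3 ^ n) := by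
  intro x hx
  have h : (0 : ℝ) < 3 ^ n := by positivity
  exact ⟨lt_of_lt_of_le (by gcongr; norm_num) hx.1, lt_of_le_of_lt hx.2 (by gcongr; norm_num)⟩

theorem cantorBand_unique {n m : ℕ} {x : ℝ} (hn : x ∈ cantorBand n) (hm : x ∈ cantorBand m) :
    n = m :=
  le_antisymm (ge_of_mem_cantorBand hm (cantorBand_subset_Ioo n hn).2)
    (le_of_mem_cantorBand hm (cantorBand_subset_Ioo n hn).1)

theorem le_third_of_mem_cantorBand {n : ℕ} {x : ℝ} (hx : x ∈ cantorBand (n + 1 + 1)) :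
    x ≤ 1 / 3 := by
  have h : (3 : ℝ) / 3 ^ (n + 2) ≤ 3 / 3 ^ 2 :=
    div_le_div_of_nonneg_left (by norm_num) (by norm_num)
      (pow_le_pow_right₀ (by norm_num) (Nat.le_add_left 2 n))
  have := hx.2.trans h
  norm_num at this ⊢
  exact this

theorem cantorBand_reflect_mem {n : ℕ} {c : ℝ} (hc : c ∈ cantorBand n) :
    5 / 3 ^ n - c ∈ cantorBand n := by
  obtain ⟨h1, h2⟩ := hc
  have : (5 : ℝ) / 3 ^ n = 2 / 3 ^ n + 3 / 3 ^ n := by ring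
  constructor <;> linarith

/-- The part of `C` in `[2/3, 1]` is a scaled copy of `C`, hence symmetric about `5/6`;
multiplication by `3` carries each further band to the one before. -/
theorem cantorSet_reflect_mem (n : ℕ) {c : ℝ} (hc : c ∈ cantorSet) (hb : c ∈ cantorBand (n + 1)) :
    5 / 3 ^ (n + 1) - c ∈ cantorSet := by
  induction n generalizing c with
  | zero =>
    have h1 : (2 : ℝ) / 3 ≤ c := by simpa using hb.1
    rcases cantorSet_cases hc with ⟨h, -⟩ | ⟨-, h⟩
    · linarith
    · convert one_sub_mem_cantorSet (div_three_mem_cantorSet (one_sub_mem_cantorSet h)) using 1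
      ring
  | succ n ih =>
    have hb' := mem_cantorBand_succ.1 hb
    rcases cantorSet_cases hc with ⟨-, h⟩ | ⟨h, -⟩
    · convert div_three_mem_cantorSet (ih h hb') using 1
      rw [pow_succ _ (n + 1)]
      ring
    · linarith [le_third_of_mem_cantorBand hb]

/-- Scaling reduces to the centre `5/6`, whose tent image is `1/2`. Hence no lower half circle
degenerates. -/
theorem cantorBand_center_not_mem (n : ℕ) : (5 / (2 * 3 ^ (n + 1)) : ℝ) ∉ cantorSet := by
  intro h
  induction n with
  | zero =>
    rcases cantorSet_cases h with ⟨h, -⟩ | ⟨-, h⟩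
    · norm_num at h
    · exact ne_half_of_mem_cantorSet h (by norm_num)
  | succ n ih =>
    rcases cantorSet_cases h with ⟨-, h⟩ | ⟨h, -⟩
    · refine ih ?_
      convert h using 1
      rw [pow_succ _ (n + 1)]
      field_simp
    · have h1 : (5 : ℝ) / (2 * 3 ^ (n + 1 + 1)) ≤ 5 / (2 * 3 ^ 2) :=
        div_le_div_of_nonneg_left (by norm_num) (by norm_num)
          (mul_le_mul_of_nonneg_left (pow_le_pow_right₀ (by norm_num) (by omega)) two_pos.le)
      have := h.trans h1
      norm_num at this

end CantorSet

/-! ### Backward orbits coded by itineraries -/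

section Itinerary

/-- A continuous function equal to `1` on `[0, 1/3]` and to `-1` on `[2/3, 1]`. -/
noncomputable def cantorSign (c : ℝ) : ℝ := max (-1) (min 1 (3 - 6 * c))

/-- The tent map of slope `3`. -/
noncomputable def cantorTent (c : ℝ) : ℝ := min (3 * c) (3 * (1 - c))

theorem cantorSign_of_le {c : ℝ} (h : c ≤ 1 / 3) : cantorSign c = 1 := by
  rw [cantorSign, min_eq_left (by linarith), max_eq_right (by norm_num)]

theorem cantorSign_of_ge {c : ℝ} (h : 2 / 3 ≤ c) : cantorSign c = -1 := by
  rw [cantorSign, min_eq_right (by linarith), max_eq_left (by linarith)]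

theorem cantorTent_of_le {c : ℝ} (h : c ≤ 1 / 3) : cantorTent c = 3 * c :=
  min_eq_left (by linarith)

theorem cantorTent_of_ge {c : ℝ} (h : 2 / 3 ≤ c) : cantorTent c = 3 * (1 - c) :=
  min_eq_right (by linarith)

theorem cantorTent_one_sub (c : ℝ) : cantorTent (1 - c) = cantorTent c := by
  rw [cantorTent, cantorTent, sub_sub_cancel, min_comm]

theorem eq_or_eq_of_cantorTent_eq {c d : ℝ} (h : cantorTent c = cantorTent d) :
    c = d ∨ d = 1 - c := by
  unfold cantorTent at h
  rcases min_cases (3 * c) (3 * (1 - c)) with ⟨h1, -⟩ | ⟨h1, -⟩ <;>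
  rcases min_cases (3 * d) (3 * (1 - d)) with ⟨h2, -⟩ | ⟨h2, -⟩ <;>
  rw [h1, h2] at h
  · left; linarith
  · right; linarith
  · right; linarith
  · left; linarith

/-- The pairs of a starting point of a backward orbit of `y ↦ 2y² - 1` and an itinerary. -/
def knasterDomain : Set (ℝ × ℝ) := Icc (-1) 1 ×ˢ cantorSet

/-- One step of the backward orbit, in which the branch is given by the itinerary. -/
noncomputable def knasterStep (s : ℝ × ℝ) : ℝ × ℝ :=
  (cantorSign s.2 * √((1 + s.1) / 2), cantorTent s.2)

/-- The backward orbit of `y ↦ 2y² - 1` with a given starting point and itinerary. -/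
noncomputable def knasterOrbit (s : ℝ × ℝ) (k : ℕ) : ℝ := (knasterStep^[k] s).1

theorem knasterOrbit_zero (s : ℝ × ℝ) : knasterOrbit s 0 = s.1 := rfl

theorem knasterOrbit_succ (s : ℝ × ℝ) (k : ℕ) :
    knasterOrbit s (k + 1) = knasterOrbit (knasterStep s) k := rfl

theorem continuous_knasterOrbit : Continuous knasterOrbit := by
  have h : Continuous knasterStep := by
    unfold knasterStep cantorSign cantorTent
    fun_prop
  exact continuous_pi fun k => continuous_fst.comp (h.iterate k)

theorem isCompact_knasterDomain : IsCompact knasterDomain :=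
  isCompact_Icc.prod isCompact_cantorSet

theorem knasterStep_cases {s : ℝ × ℝ} (hs : s ∈ knasterDomain) :
    (s.2 ≤ 1 / 3 ∧ 3 * s.2 ∈ cantorSet ∧ knasterStep s = (√((1 + s.1) / 2), 3 * s.2)) ∨
    (2 / 3 ≤ s.2 ∧ 3 * (1 - s.2) ∈ cantorSet ∧
      knasterStep s = (-√((1 + s.1) / 2), 3 * (1 - s.2))) := by
  rcases cantorSet_cases hs.2 with ⟨h1, h2⟩ | ⟨h1, h2⟩
  · refine Or.inl ⟨h1, h2, ?_⟩
    rw [knasterStep, cantorSign_of_le h1, cantorTent_of_le h1, one_mul]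
  · refine Or.inr ⟨h1, h2, ?_⟩
    rw [knasterStep, cantorSign_of_ge h1, cantorTent_of_ge h1, neg_one_mul]

theorem knasterStep_mem {s : ℝ × ℝ} (hs : s ∈ knasterDomain) : knasterStep s ∈ knasterDomain := by
  have h0 := Real.sqrt_nonneg ((1 + s.1) / 2)
  have h1 : √((1 + s.1) / 2) ≤ 1 := Real.sqrt_le_one.2 (by linarith [hs.1.2])
  rcases knasterStep_cases hs with ⟨-, h2, h3⟩ | ⟨-, h2, h3⟩ <;> rw [h3]
  · exact ⟨⟨by linarith, h1⟩, h2⟩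
  · exact ⟨⟨by linarith, by linarith⟩, h2⟩

theorem knasterStep_fst_sq {s : ℝ × ℝ} (hs : s ∈ knasterDomain) :
    s.1 = 2 * (knasterStep s).1 ^ 2 - 1 := by
  have h := Real.sq_sqrt (show 0 ≤ (1 + s.1) / 2 by linarith [hs.1.1])
  rcases knasterStep_cases hs with ⟨-, -, h3⟩ | ⟨-, -, h3⟩ <;> rw [h3]
  · change s.1 = 2 * √((1 + s.1) / 2) ^ 2 - 1
    linarith
  · change s.1 = 2 * (-√((1 + s.1) / 2)) ^ 2 - 1
    rw [neg_sq]
    linarith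

theorem knasterOrbit_mem {s : ℝ × ℝ} (hs : s ∈ knasterDomain) (k : ℕ) :
    knasterOrbit s k ∈ Icc (-1 : ℝ) 1 ∧
      knasterOrbit s k = 2 * knasterOrbit s (k + 1) ^ 2 - 1 := by
  induction k generalizing s with
  | zero => exact ⟨hs.1, knasterStep_fst_sq hs⟩
  | succ k ih => exact ih (knasterStep_mem hs)

/-- The itinerary is built by recursion on the shifted orbit: the sign of `y 1` decides in which
third its code is inserted. -/
theorem exists_knasterOrbit_eq {y : ℕ → ℝ} (h1 : ∀ k, y k ∈ Icc (-1 : ℝ) 1)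
    (h2 : ∀ k, y k = 2 * y (k + 1) ^ 2 - 1) (n : ℕ) :
    ∃ s ∈ knasterDomain, ∀ k ≤ n, knasterOrbit s k = y k := by
  induction n generalizing y with
  | zero =>
    refine ⟨(y 0, 0), ⟨h1 0, zero_mem_cantorSet⟩, fun k hk => ?_⟩
    rw [Nat.le_zero.1 hk, knasterOrbit_zero]
  | succ n ih =>
    obtain ⟨s, hs, e⟩ := ih (y := fun k => y (k + 1)) (fun k => h1 _) fun k => h2 _
    have e0 : s.1 = y 1 := e 0 (Nat.zero_le _)
    have hsq : (1 + y 0) / 2 = y 1 ^ 2 := by rw [h2 0]; ring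
    obtain ⟨hc0, hc1⟩ := cantorSet_subset_unitInterval hs.2
    have : ∃ t ∈ knasterDomain, t.1 = y 0 ∧ knasterStep t = s := by
      rcases le_total 0 (y 1) with hy | hy
      · refine ⟨(y 0, s.2 / 3), ⟨h1 0, div_three_mem_cantorSet hs.2⟩, rfl, Prod.ext ?_ ?_⟩
        · change cantorSign (s.2 / 3) * √((1 + y 0) / 2) = s.1
          rw [cantorSign_of_le (by linarith), hsq, Real.sqrt_sq hy, one_mul, e0]
        · change cantorTent (s.2 / 3) = s.2
          rw [cantorTent_of_le (by linarith)]
          ring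
      · refine ⟨(y 0, 1 - s.2 / 3),
          ⟨h1 0, one_sub_mem_cantorSet (div_three_mem_cantorSet hs.2)⟩, rfl, Prod.ext ?_ ?_⟩
        · change cantorSign (1 - s.2 / 3) * √((1 + y 0) / 2) = s.1
          rw [cantorSign_of_ge (by linarith), hsq, Real.sqrt_sq_eq_abs, abs_of_nonpos hy, e0]
          ring
        · change cantorTent (1 - s.2 / 3) = s.2
          rw [cantorTent_of_ge (by linarith)]
          ring
    obtain ⟨t, ht, ht0, ht1⟩ := this
    refine ⟨t, ht, fun k hk => ?_⟩
    cases k with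
    | zero => rw [knasterOrbit_zero, ht0]
    | succ k => rw [knasterOrbit_succ, ht1, e k (by omega)]

/-- The identifications on `[-1, 1] × C` that produce the Knaster continuum. -/
def KnasterRel (s t : ℝ × ℝ) : Prop :=
  s.1 = t.1 ∧ (s.2 = t.2 ∨ (s.1 = -1 ∧ t.2 = 1 - s.2) ∨
    (s.1 = 1 ∧ ∃ n, s.2 ∈ cantorBand (n + 1) ∧ t.2 = 5 / 3 ^ (n + 1) - s.2))

theorem knasterOrbit_eq_of_step_eq {s t : ℝ × ℝ} (h1 : s.1 = t.1) (h : knasterStep s = knasterStep t) :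
    knasterOrbit s = knasterOrbit t := by
  funext k
  cases k with
  | zero => exact h1
  | succ k => rw [knasterOrbit_succ, knasterOrbit_succ, h]

/-- From `-1` the next value is `0`, where the sign is immaterial, and the tent map does not
distinguish `c` from `1 - c`. -/
theorem knasterOrbit_neg_one (c : ℝ) : knasterOrbit (-1, c) = knasterOrbit (-1, 1 - c) := by
  refine knasterOrbit_eq_of_step_eq rfl ?_
  simp [knasterStep, cantorTent_one_sub]

/-- The orbit stays at `1` while the code is tripled into the last third, then moves to `-1`. There
the reflection of the band has become `x ↦ 1 - x`. -/
theorem knasterOrbit_one_reflect (n : ℕ) {c : ℝ} (hc : c ∈ cantorBand (n + 1)) (hc1 : c ∈ cantorSet) :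
    knasterOrbit (1, c) = knasterOrbit (1, 5 / 3 ^ (n + 1) - c) := by
  have hd := cantorBand_reflect_mem hc
  funext k
  cases k with
  | zero => rfl
  | succ k =>
    rw [knasterOrbit_succ, knasterOrbit_succ]
    induction n generalizing c k with
    | zero =>
      have h1 : 2 / 3 ≤ c := by simpa using hc.1
      have h2 : 2 / 3 ≤ 5 / 3 ^ (0 + 1) - c := by simpa using hd.1
      simp only [knasterStep, cantorSign_of_ge h1, cantorTent_of_ge h1, cantorSign_of_ge h2,
        cantorTent_of_ge h2]
      norm_num
      rw [knasterOrbit_neg_one]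
      congr 2
      ring
    | succ n ih =>
      have h3c : 3 * c ∈ cantorSet := by
        rcases cantorSet_cases hc1 with h | h
        · exact h.2
        · linarith [le_third_of_mem_cantorBand hc, h.1]
      simp only [knasterStep, cantorSign_of_le (le_third_of_mem_cantorBand hc), cantorTent_of_le (le_third_of_mem_cantorBand hc),
        cantorSign_of_le (le_third_of_mem_cantorBand hd), cantorTent_of_le (le_third_of_mem_cantorBand hd)]
      norm_num
      have e : 3 * (5 / 3 ^ (n + 1 + 1) - c) = 5 / 3 ^ (n + 1) - 3 * c := by
        rw [pow_succ _ (n + 1)]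
        ring
      rw [e]
      have hb := mem_cantorBand_succ.1 hc
      cases k with
      | zero => rfl
      | succ k => exact ih hb h3c (cantorBand_reflect_mem hb) k

theorem KnasterRel.knasterOrbit_eq {s t : ℝ × ℝ} (hs : s ∈ knasterDomain) (h : KnasterRel s t) :
    knasterOrbit s = knasterOrbit t := by
  obtain ⟨y, c⟩ := s
  obtain ⟨z, d⟩ := t
  obtain ⟨h0, h1⟩ := h
  simp only at h0 h1
  subst h0
  rcases h1 with rfl | ⟨rfl, rfl⟩ | ⟨rfl, n, h2, rfl⟩
  · rfl
  · exact knasterOrbit_neg_one c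
  · exact knasterOrbit_one_reflect n h2 hs.2

theorem knasterOrbit_step_eq {s t : ℝ × ℝ} (h : knasterOrbit s = knasterOrbit t) :
    knasterOrbit (knasterStep s) = knasterOrbit (knasterStep t) := by
  funext k
  exact congr_fun h (k + 1)

/-- Two points with the same orbit lie in the same third, if the orbit does not start at `-1`. -/
theorem knasterStep_cases_of_eq {s t : ℝ × ℝ} (hs : s ∈ knasterDomain) (ht : t ∈ knasterDomain)
    (h1 : -1 < s.1) (h : knasterOrbit s = knasterOrbit t) :
    (s.2 ≤ 1 / 3 ∧ t.2 ≤ 1 / 3 ∧ knasterStep s = (√((1 + s.1) / 2), 3 * s.2) ∧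
      knasterStep t = (√((1 + s.1) / 2), 3 * t.2)) ∨
    (2 / 3 ≤ s.2 ∧ 2 / 3 ≤ t.2 ∧ knasterStep s = (-√((1 + s.1) / 2), 3 * (1 - s.2)) ∧
      knasterStep t = (-√((1 + s.1) / 2), 3 * (1 - t.2))) := by
  have h0 : s.1 = t.1 := congr_fun h 0
  have he : (knasterStep s).1 = (knasterStep t).1 := congr_fun h 1
  have hpos : 0 < √((1 + s.1) / 2) := Real.sqrt_pos.2 (by linarith)
  rcases knasterStep_cases hs with ⟨h2, -, h3⟩ | ⟨h2, -, h3⟩ <;>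
  rcases knasterStep_cases ht with ⟨h4, -, h5⟩ | ⟨h4, -, h5⟩ <;>
  rw [← h0] at h5
  · exact Or.inl ⟨h2, h4, h3, h5⟩
  · rw [h3, h5] at he
    simp only at he
    linarith
  · rw [h3, h5] at he
    simp only at he
    linarith
  · exact Or.inr ⟨h2, h4, h3, h5⟩

/-- The orbit never leaves `(-1, 1)` and after its start never vanishes, so its signs determine the
thirds. Each step thus triples the distance between the codes, which never exceeds `1`. -/
theorem eq_of_knasterOrbit_eq {s t : ℝ × ℝ} (hs : s ∈ knasterDomain) (ht : t ∈ knasterDomain)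
    (h1 : s.1 ∈ Ioo (-1 : ℝ) 1) (h : knasterOrbit s = knasterOrbit t) : s.2 = t.2 := by
  have key : ∀ k : ℕ, |s.2 - t.2| ≤ (1 / 3) ^ k := by
    intro k
    induction k generalizing s t with
    | zero =>
      have h2 := cantorSet_subset_unitInterval hs.2
      have h3 := cantorSet_subset_unitInterval ht.2
      rw [pow_zero, abs_le]
      constructor <;> linarith [h2.1, h2.2, h3.1, h3.2]
    | succ k ih =>
      have hpos : 0 < √((1 + s.1) / 2) := Real.sqrt_pos.2 (by linarith [h1.1])
      have hlt : √((1 + s.1) / 2) < 1 := by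
        rw [Real.sqrt_lt' one_pos]
        linarith [h1.2]
      rw [pow_succ]
      rcases knasterStep_cases_of_eq hs ht h1.1 h with ⟨-, -, h3, h4⟩ | ⟨-, -, h3, h4⟩
      · have := ih (knasterStep_mem hs) (knasterStep_mem ht) (by rw [h3]; constructor <;> simp only <;> linarith)
          (knasterOrbit_step_eq h)
        rw [h3, h4] at this
        simp only [← mul_sub, abs_mul] at this
        norm_num at this ⊢
        linarith
      · have := ih (knasterStep_mem hs) (knasterStep_mem ht) (by rw [h3]; constructor <;> simp only <;> linarith)
          (knasterOrbit_step_eq h)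
        rw [h3, h4] at this
        simp only [← mul_sub, sub_sub_sub_cancel_left, abs_mul] at this
        rw [abs_sub_comm] at this
        norm_num at this ⊢
        linarith
  have hlim := tendsto_pow_atTop_nhds_zero_of_lt_one (by norm_num : (0 : ℝ) ≤ 1 / 3) (by norm_num)
  have := ge_of_tendsto' hlim key
  exact sub_eq_zero.1 (abs_nonpos_iff.1 this)

theorem eq_or_eq_of_knasterOrbit_neg_one {c d : ℝ} (hc : c ∈ cantorSet) (hd : d ∈ cantorSet)
    (h : knasterOrbit (-1, c) = knasterOrbit (-1, d)) : c = d ∨ d = 1 - c := by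
  have hm : ∀ x ∈ cantorSet, ((-1 : ℝ), x) ∈ knasterDomain := fun x hx => ⟨by simp, hx⟩
  refine eq_or_eq_of_cantorTent_eq (eq_of_knasterOrbit_eq (knasterStep_mem (hm c hc))
    (knasterStep_mem (hm d hd)) ?_ (knasterOrbit_step_eq h))
  simp [knasterStep]

theorem eq_or_eq_of_knasterOrbit_one (n : ℕ) {c d : ℝ} (hc : c ∈ cantorSet) (hd : d ∈ cantorSet)
    (hn : c ∈ cantorBand (n + 1)) (h : knasterOrbit (1, c) = knasterOrbit (1, d)) :
    c = d ∨ d = 5 / 3 ^ (n + 1) - c := by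
  have hm : ∀ x ∈ cantorSet, ((1 : ℝ), x) ∈ knasterDomain := fun x hx => ⟨by simp, hx⟩
  have hcm := knasterStep_mem (hm c hc)
  have hdm := knasterStep_mem (hm d hd)
  have hcs := knasterStep_cases_of_eq (hm c hc) (hm d hd) (by norm_num) h
  have hst := knasterOrbit_step_eq h
  norm_num at hcs
  induction n generalizing c d with
  | zero =>
    have h1 : 2 / 3 ≤ c := by simpa using hn.1
    rcases hcs with ⟨h2, -⟩ | ⟨-, -, h3, h4⟩
    · linarith
    · rw [h3] at hcm hst
      rw [h4] at hdm hst
      rcases eq_or_eq_of_knasterOrbit_neg_one hcm.2 hdm.2 hst with e | e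
      · left; linarith
      · right; norm_num; linarith
  | succ n ih =>
    rcases hcs with ⟨-, -, h3, h4⟩ | ⟨h2, -⟩
    · rw [h3] at hcm hst
      rw [h4] at hdm hst
      have hcs' := knasterStep_cases_of_eq hcm hdm (by norm_num) hst
      norm_num at hcs'
      rcases ih hcm.2 hdm.2 (mem_cantorBand_succ.1 hn) hst (knasterStep_mem hcm)
        (knasterStep_mem hdm) (knasterOrbit_step_eq hst) hcs' with e | e
      · left; linarith
      · right
        rw [pow_succ _ (n + 1)]
        have : (5 : ℝ) / (3 ^ (n + 1) * 3) = 5 / 3 ^ (n + 1) / 3 := by ring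
        rw [this]
        linarith
    · linarith [le_third_of_mem_cantorBand hn]

theorem knasterRel_of_knasterOrbit_eq {s t : ℝ × ℝ} (hs : s ∈ knasterDomain)
    (ht : t ∈ knasterDomain) (h : knasterOrbit s = knasterOrbit t) : KnasterRel s t := by
  obtain ⟨y, c⟩ := s
  obtain ⟨z, d⟩ := t
  obtain rfl : y = z := congr_fun h 0
  refine ⟨rfl, ?_⟩
  rcases hs.1.1.eq_or_lt with e | h1
  · simp only at e
    subst e
    rcases eq_or_eq_of_knasterOrbit_neg_one hs.2 ht.2 h with e | e
    · exact Or.inl e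
    · exact Or.inr (Or.inl ⟨rfl, e⟩)
  rcases hs.1.2.eq_or_lt with e | h2
  · simp only at e
    subst e
    -- The code `0` lies in no band. If `d` is in a band, the lemma is applied with the roles
    -- exchanged, and positivity of the reflected point excludes `c = 0`.
    by_cases hc : c = 0
    · by_cases hd : d = 0
      · exact Or.inl (hc.trans hd.symm)
      · obtain ⟨n, hn⟩ := exists_mem_cantorBand ht.2 hd
        rcases eq_or_eq_of_knasterOrbit_one n ht.2 hs.2 hn h.symm with e | e
        · exact Or.inl e.symm
        · have := pos_of_mem_cantorBand (cantorBand_reflect_mem hn)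
          simp only at e
          linarith
    · obtain ⟨n, hn⟩ := exists_mem_cantorBand hs.2 hc
      rcases eq_or_eq_of_knasterOrbit_one n hs.2 ht.2 hn h with e | e
      · exact Or.inl e
      · exact Or.inr (Or.inr ⟨rfl, n, hn, e⟩)
  · exact Or.inl (eq_of_knasterOrbit_eq hs ht ⟨h1, h2⟩ h)

end Itinerary

/-! ### `K_2` as the space of backward orbits of `y ↦ 2y² - 1` -/

namespace KContinuum

theorem bondingExponent_two (k : ℕ) : bondingExponent 2 k = 2 := rfl

theorem solenoidDegree_two (k : ℕ) : solenoidDegree 2 k = 2 ^ k := by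
  induction k with
  | zero => rfl
  | succ k ih => rw [solenoidDegree_succ, ih, bondingExponent_two, pow_succ]

theorem mem_range_coord_two {y : ℕ → ℝ} (h1 : ∀ k, y k ∈ Icc (-1 : ℝ) 1)
    (h2 : ∀ k, y k = 2 * y (k + 1) ^ 2 - 1) : y ∈ range (coord (p := 2)) := by
  rw [← image_univ]
  refine mem_image_coord_of_forall_le isClosed_univ fun n =>
    ⟨line le_rfl (2 ^ n * Real.arccos (y n)), mem_univ _, fun k hk => ?_⟩
  rw [coord_line, solenoidDegree_two]
  push_cast
  induction hk using Nat.decreasingInduction with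
  | self =>
    rw [mul_div_cancel_left₀ _ (by positivity), Real.cos_arccos (h1 n).1 (h1 n).2]
  | of_succ k _ ih =>
    rw [h2 k, ← ih, ← Real.cos_two_mul, pow_succ]
    congr 1
    field_simp

theorem coord_two (w : KContinuum 2) (k : ℕ) : coord w k = 2 * coord w (k + 1) ^ 2 - 1 := by
  rw [coord_eq_cos le_rfl w (Nat.le_succ k), solenoidDegree_two, solenoidDegree_two]
  have h := coord_mem_Icc w (k + 1)
  have e : ((2 ^ (k + 1) : ℕ) : ℝ) * Real.arccos (coord w (k + 1)) / ((2 ^ k : ℕ) : ℝ) =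
      2 * Real.arccos (coord w (k + 1)) := by
    push_cast
    rw [pow_succ]
    field_simp
  rw [e, Real.cos_two_mul, Real.cos_arccos h.1 h.2]

end KContinuum

/-! ### Parametrization of the bucket handle by quarter circles -/

section HalfCircles

theorem abs_mul_sqrt_sq (d : ℝ) {r : ℝ} (hr : r ∈ Icc (0 : ℝ) 1) :
    (d * r) ^ 2 + (|d| * √(1 - r ^ 2)) ^ 2 = d ^ 2 := by
  rw [mul_pow |d|, Real.sq_sqrt (by nlinarith [hr.1, hr.2]), sq_abs]
  ring

/-- Two points on quarter circles about the origin coincide only if the quarter circles do,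
or if both are the common top. -/
theorem quarterCircle_inj {d e r t : ℝ} (hd : d ≠ 0) (hr : r ∈ Icc (0 : ℝ) 1)
    (ht : t ∈ Icc (0 : ℝ) 1) (h1 : d * r = e * t)
    (h2 : |d| * √(1 - r ^ 2) = |e| * √(1 - t ^ 2)) :
    (e = d ∧ r = t) ∨ (e = -d ∧ r = 0 ∧ t = 0) := by
  have hsq : d ^ 2 = e ^ 2 := by
    rw [← abs_mul_sqrt_sq d hr, ← abs_mul_sqrt_sq e ht, h1, h2]
  rcases sq_eq_sq_iff_eq_or_eq_neg.1 hsq with rfl | rfl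
  · exact Or.inl ⟨rfl, mul_left_cancel₀ hd h1⟩
  · have he : e ≠ 0 := neg_ne_zero.1 hd
    have : -r = t := mul_left_cancel₀ he (by linarith)
    exact Or.inr ⟨by ring, by linarith [hr.1, ht.1], by linarith [hr.1, ht.1]⟩

/-- The top splits a half circle into quarter circles ending at `d` and `-d`; the sign of `a / d`
selects the one containing the point. -/
theorem exists_quarterCircle {d a b : ℝ} (hd : d ≠ 0) (hb : 0 ≤ b) (h : a ^ 2 + b ^ 2 = d ^ 2) :
    ∃ e r, (e = d ∨ e = -d) ∧ r ∈ Icc (0 : ℝ) 1 ∧ a = e * r ∧ b = |e| * √(1 - r ^ 2) := by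
  have hle : |a / d| ≤ 1 := by
    rw [abs_div, div_le_one (abs_pos.2 hd)]
    exact sq_le_sq.1 (by nlinarith)
  have hb' : ∀ e r, e ^ 2 = d ^ 2 → a = e * r → b = |e| * √(1 - r ^ 2) := by
    intro e r he ha
    rw [← Real.sqrt_sq_eq_abs, ← Real.sqrt_mul (sq_nonneg _), ← Real.sqrt_sq hb]
    congr 1
    rw [ha] at h
    linarith [mul_pow e r 2]
  rcases le_total 0 (a / d) with h0 | h0
  · have ha : a = d * (a / d) := by field_simp
    exact ⟨d, a / d, Or.inl rfl, ⟨h0, (le_abs_self _).trans hle⟩, ha, hb' _ _ rfl ha⟩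
  · have ha : a = -d * -(a / d) := by field_simp
    exact ⟨-d, -(a / d), Or.inr rfl, ⟨neg_nonneg.2 h0, (neg_le_abs _).trans hle⟩, ha,
      hb' _ _ (neg_sq d) ha⟩

/-- The centre of the lower half circles of the Knaster continuum that end at `c`. -/
noncomputable def bandCenter (c : ℝ) : ℝ :=
  open Classical in
  if h : ∃ n, c ∈ cantorBand (n + 1) then 5 / (2 * 3 ^ (h.choose + 1)) else 0

theorem bandCenter_eq {n : ℕ} {c : ℝ} (h : c ∈ cantorBand (n + 1)) :
    bandCenter c = 5 / (2 * 3 ^ (n + 1)) := by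
  have hex : ∃ n, c ∈ cantorBand (n + 1) := ⟨n, h⟩
  rw [bandCenter, dif_pos hex, cantorBand_unique hex.choose_spec h]

theorem bandCenter_zero : bandCenter 0 = 0 :=
  dif_neg fun ⟨_, hn⟩ => (pos_of_mem_cantorBand hn).ne rfl

theorem bandCenter_mem {n : ℕ} {c : ℝ} (h : c ∈ cantorBand (n + 1)) :
    bandCenter c ∈ cantorBand (n + 1) := by
  rw [bandCenter_eq h]
  have : (5 : ℝ) / (2 * 3 ^ (n + 1)) = 5 / 2 / 3 ^ (n + 1) := by rw [div_div]
  rw [this]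
  constructor <;> gcongr <;> norm_num

theorem reflect_eq {n : ℕ} {c : ℝ} (h : c ∈ cantorBand (n + 1)) :
    5 / 3 ^ (n + 1) - c = 2 * bandCenter c - c := by
  rw [bandCenter_eq h]
  field_simp

theorem bandCenter_ne {n : ℕ} {c : ℝ} (hc : c ∈ cantorSet) (h : c ∈ cantorBand (n + 1)) :
    c - bandCenter c ≠ 0 := fun e => by
  rw [bandCenter_eq h] at e
  exact cantorBand_center_not_mem n (sub_eq_zero.1 e ▸ hc)

/-- These linear bounds make the lower half circles shrink to the origin as `c → 0`. -/
theorem abs_sub_bandCenter_le {c : ℝ} (hc : c ∈ cantorSet) :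
    0 ≤ bandCenter c ∧ bandCenter c ≤ 2 * c ∧ |c - bandCenter c| ≤ c := by
  by_cases h0 : c = 0
  · subst h0
    simp [bandCenter_zero]
  · obtain ⟨n, hn⟩ := exists_mem_cantorBand hc h0
    have hm := bandCenter_mem hn
    have h1 := pos_of_mem_cantorBand hm
    have h2 := hn.1
    have h3 := hm.2
    have h4 : (2 : ℝ) / 3 ^ (n + 1) = 2 * (1 / 3 ^ (n + 1)) := by ring
    have h5 : (3 : ℝ) / 3 ^ (n + 1) = 3 * (1 / 3 ^ (n + 1)) := by ring
    rw [h4] at h2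
    rw [h5] at h3
    have h6 : (0 : ℝ) < 1 / 3 ^ (n + 1) := by positivity
    refine ⟨h1.le, by linarith, abs_le.2 ⟨by linarith, by linarith⟩⟩

theorem continuousWithinAt_bandCenter {c : ℝ} (hc : c ∈ cantorSet) (h0 : c ≠ 0) :
    ContinuousWithinAt bandCenter cantorSet c := by
  obtain ⟨n, hn⟩ := exists_mem_cantorBand hc h0
  have hev : ∀ᶠ x in 𝓝[cantorSet] c, bandCenter x = bandCenter c := by
    have hI := cantorBand_subset_Ioo _ hn
    filter_upwards [mem_nhdsWithin_of_mem_nhds (Ioo_mem_nhds hI.1 hI.2), self_mem_nhdsWithin]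
      with x hx hxc
    obtain ⟨m, hm⟩ := exists_mem_cantorBand hxc
      (ne_of_gt (lt_trans (by positivity) hx.1))
    have e : m + 1 = n + 1 := le_antisymm (le_of_mem_cantorBand hm hx.1)
      (ge_of_mem_cantorBand hm hx.2)
    rw [e] at hm
    rw [bandCenter_eq hm, bandCenter_eq hn]
  exact continuousWithinAt_const.congr_of_eventuallyEq hev rfl

/-- The point with parameter `r` on the upper quarter circle that ends at `(c, 0)`. -/
noncomputable def upperPoint (c r : ℝ) : ℝ × ℝ :=
  (1 / 2 + (c - 1 / 2) * r, |c - 1 / 2| * √(1 - r ^ 2))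

/-- The point with parameter `r` on the lower quarter circle that ends at `(c, 0)`. -/
noncomputable def lowerPoint (c r : ℝ) : ℝ × ℝ :=
  (bandCenter c + (c - bandCenter c) * r, -(|c - bandCenter c| * √(1 - r ^ 2)))

/-- The parametrization of the Knaster continuum: each end point `c` of half circles
carries the union of an upper and a lower quarter circle. -/
noncomputable def knasterMap (s : ℝ × ℝ) : ℝ × ℝ :=
  if s.1 ≤ 1 - s.2 then upperPoint s.2 ((s.1 + 1) / (2 - s.2))
  else lowerPoint s.2 ((1 - s.1) / s.2)

theorem knasterMap_of_le {s : ℝ × ℝ} (h : s.1 ≤ 1 - s.2) :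
    knasterMap s = upperPoint s.2 ((s.1 + 1) / (2 - s.2)) := if_pos h

theorem upper_param_mem {s : ℝ × ℝ} (hs : s ∈ knasterDomain) (h : s.1 ≤ 1 - s.2) :
    (s.1 + 1) / (2 - s.2) ∈ Icc (0 : ℝ) 1 := by
  have h1 := (cantorSet_subset_unitInterval hs.2).2
  refine ⟨div_nonneg (by linarith [hs.1.1]) (by linarith), ?_⟩
  rw [div_le_one (by linarith)]
  linarith

theorem lower_param_mem {s : ℝ × ℝ} (hs : s ∈ knasterDomain) (h : 1 - s.2 ≤ s.1) :
    (1 - s.1) / s.2 ∈ Icc (0 : ℝ) 1 := by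
  have h1 := (cantorSet_subset_unitInterval hs.2).1
  exact ⟨div_nonneg (by linarith [hs.1.2]) h1, div_le_one_of_le₀ (by linarith) h1⟩

theorem knasterMap_of_ge {s : ℝ × ℝ} (hs : s ∈ knasterDomain) (h : 1 - s.2 ≤ s.1) :
    knasterMap s = lowerPoint s.2 ((1 - s.1) / s.2) := by
  rcases h.eq_or_lt with e | h'
  · have hc1 := (cantorSet_subset_unitInterval hs.2).2
    rw [knasterMap_of_le e.ge, ← e]
    have e1 : (1 - s.2 + 1) / (2 - s.2) = 1 := by
      rw [div_eq_one_iff_eq (by linarith)]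
      ring
    rw [e1, sub_sub_cancel]
    -- For `c = 0` the lower parameter is `0 / 0 = 0` instead of `1`, which is harmless since the
    -- lower quarter circle is the origin alone.
    by_cases h0 : s.2 = 0
    · simp [upperPoint, lowerPoint, h0, bandCenter_zero]
    · simp [upperPoint, lowerPoint, div_self h0]
  · exact if_neg (not_le.2 h')

/-- Away from `c = 0` the centre is locally constant on `C`. At `c = 0` the parameter need not
converge, but the point has norm at most `3 * c`. -/
theorem continuousOn_lowerPoint :
    ContinuousOn (fun s : ℝ × ℝ => lowerPoint s.2 ((1 - s.1) / s.2))
      (knasterDomain ∩ {s | 1 - s.2 ≤ s.1}) := by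
  rintro ⟨y, c⟩ ⟨hs, h⟩
  by_cases h0 : c = 0
  · have hb : ∀ᶠ s in 𝓝[knasterDomain ∩ {s | 1 - s.2 ≤ s.1}] (y, c),
        ‖lowerPoint s.2 ((1 - s.1) / s.2)‖ ≤ 3 * s.2 := by
      filter_upwards [self_mem_nhdsWithin] with s hs
      obtain ⟨h1, h2, h3⟩ := abs_sub_bandCenter_le hs.1.2
      have hr := lower_param_mem hs.1 hs.2
      set r := (1 - s.1) / s.2
      have h4 : √(1 - r ^ 2) ≤ 1 := Real.sqrt_le_one.2 (by nlinarith [hr.1])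
      have h5 := Real.sqrt_nonneg (1 - r ^ 2)
      rw [lowerPoint, Prod.norm_mk, max_le_iff, Real.norm_eq_abs, Real.norm_eq_abs]
      have hc := (cantorSet_subset_unitInterval hs.1.2).1
      constructor
      · refine (abs_add_le _ _).trans ?_
        rw [abs_of_nonneg h1, abs_mul, abs_of_nonneg hr.1]
        nlinarith [mul_le_of_le_one_right (abs_nonneg (s.2 - bandCenter s.2)) hr.2]
      · rw [abs_neg, abs_mul, abs_abs, abs_of_nonneg h5]
        nlinarith [mul_le_of_le_one_right (abs_nonneg (s.2 - bandCenter s.2)) h4]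
    have hz : lowerPoint c ((1 - y) / c) = 0 := by
      simp [lowerPoint, h0, bandCenter_zero]
    change Tendsto _ _ (𝓝 (lowerPoint c ((1 - y) / c)))
    rw [hz]
    refine squeeze_zero_norm' hb ?_
    have : Tendsto (fun s : ℝ × ℝ => 3 * s.2) (𝓝 (y, c)) (𝓝 (3 * c)) :=
      Continuous.tendsto (f := fun s : ℝ × ℝ => 3 * s.2) (by fun_prop) (y, c)
    rw [h0, mul_zero] at this
    exact h0 ▸ this.mono_left nhdsWithin_le_nhds
  · have hm : ContinuousWithinAt (fun s : ℝ × ℝ => bandCenter s.2)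
        (knasterDomain ∩ {s | 1 - s.2 ≤ s.1}) (y, c) :=
      (continuousWithinAt_bandCenter hs.2 h0).comp continuous_snd.continuousWithinAt
        fun s hs => hs.1.2
    have hr : ContinuousWithinAt (fun s : ℝ × ℝ => (1 - s.1) / s.2)
        (knasterDomain ∩ {s | 1 - s.2 ≤ s.1}) (y, c) :=
      ContinuousWithinAt.div (by fun_prop) (by fun_prop) h0
    have hc : ContinuousWithinAt (fun s : ℝ × ℝ => s.2)
        (knasterDomain ∩ {s | 1 - s.2 ≤ s.1}) (y, c) := continuous_snd.continuousWithinAt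
    exact (hm.add ((hc.sub hm).mul hr)).prodMk
      ((hc.sub hm).abs.mul (continuousWithinAt_const.sub (hr.pow 2)).sqrt).neg

theorem continuousOn_knasterMap : ContinuousOn knasterMap knasterDomain := by
  have h1 : ContinuousOn knasterMap (knasterDomain ∩ {s | s.1 ≤ 1 - s.2}) := by
    refine ContinuousOn.congr (f := fun s => upperPoint s.2 ((s.1 + 1) / (2 - s.2))) ?_
      fun s hs => knasterMap_of_le hs.2
    have hr : ContinuousOn (fun s : ℝ × ℝ => (s.1 + 1) / (2 - s.2))
        (knasterDomain ∩ {s | s.1 ≤ 1 - s.2}) :=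
      ContinuousOn.div (by fun_prop) (by fun_prop) fun s hs => by
        linarith [(cantorSet_subset_unitInterval hs.1.2).2]
    unfold upperPoint
    fun_prop
  have h2 : ContinuousOn knasterMap (knasterDomain ∩ {s | 1 - s.2 ≤ s.1}) :=
    continuousOn_lowerPoint.congr fun s hs => knasterMap_of_ge hs.1 hs.2
  have hcl := isCompact_knasterDomain.isClosed
  have := h1.union_of_isClosed h2 (hcl.inter (isClosed_le (by fun_prop) (by fun_prop)))
    (hcl.inter (isClosed_le (by fun_prop) (by fun_prop)))
  refine this.mono fun s hs => ?_
  rcases le_total s.1 (1 - s.2) with h | h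
  · exact Or.inl ⟨hs, h⟩
  · exact Or.inr ⟨hs, h⟩

theorem knasterMap_mem {s : ℝ × ℝ} (hs : s ∈ knasterDomain) : knasterMap s ∈ knasterContinuum := by
  rcases le_or_gt s.1 (1 - s.2) with h | h
  · rw [knasterMap_of_le h]
    refine Or.inl ⟨mul_nonneg (abs_nonneg _) (Real.sqrt_nonneg _), s.2, hs.2, ?_⟩
    rw [← abs_mul_sqrt_sq (s.2 - 1 / 2) (upper_param_mem hs h)]
    simp [upperPoint]
  · rw [knasterMap_of_ge hs h.le]
    obtain ⟨n, hn⟩ := exists_mem_cantorBand hs.2 (c := s.2) fun h0 => by linarith [hs.1.2]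
    refine Or.inr ⟨neg_nonpos.2 (mul_nonneg (abs_nonneg _) (Real.sqrt_nonneg _)), n + 1,
      Nat.le_add_left 1 n, s.2, ⟨hs.2, hn⟩, ?_⟩
    rw [← bandCenter_eq hn, ← abs_mul_sqrt_sq (s.2 - bandCenter s.2) (lower_param_mem hs h.le)]
    simp [lowerPoint]

theorem exists_knasterMap_eq {q : ℝ × ℝ} (hq : q ∈ knasterContinuum) :
    ∃ s ∈ knasterDomain, knasterMap s = q := by
  rcases hq with ⟨h0, c, hc, h⟩ | ⟨h0, n, hn, c, ⟨hc, hb⟩, h⟩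
  · obtain ⟨e, r, he, hr, h1, h2⟩ :=
      exists_quarterCircle (sub_ne_zero.2 (ne_half_of_mem_cantorSet hc)) h0 h
    have hec : 1 / 2 + e ∈ cantorSet := by
      rcases he with rfl | rfl
      · convert hc using 1
        ring
      · convert one_sub_mem_cantorSet hc using 1
        ring
    generalize hd : 1 / 2 + e = d at hec
    obtain rfl : e = d - 1 / 2 := by rw [← hd]; ring
    have hd1 := cantorSet_subset_unitInterval hec
    have hle : r * (2 - d) - 1 ≤ 1 - d := by nlinarith [hr.2, hd1.2]
    -- This solves `(y + 1) / (2 - d) = r` for `y`; below, `1 - r * d` does the same for the lower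
    -- parameter.
    refine ⟨(r * (2 - d) - 1, d), ⟨⟨?_, ?_⟩, hec⟩, ?_⟩
    · nlinarith [hr.1, hd1.2]
    · linarith [hd1.1]
    · rw [knasterMap_of_le hle]
      have : (r * (2 - d) - 1 + 1) / (2 - d) = r := by
        rw [sub_add_cancel, mul_div_cancel_right₀ _ (by linarith [hd1.2])]
      simp only [this]
      refine Prod.ext ?_ h2.symm
      change 1 / 2 + (d - 1 / 2) * r = q.1
      linarith
  · obtain ⟨n, rfl⟩ := Nat.exists_eq_add_of_le' hn
    change c ∈ cantorBand (n + 1) at hb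
    rw [← bandCenter_eq hb] at h
    obtain ⟨e, r, he, hr, h1, h2⟩ :=
      exists_quarterCircle (a := q.1 - bandCenter c) (b := -q.2) (bandCenter_ne hc hb) (neg_nonneg.2 h0) (by rwa [neg_sq])
    have hec : ∃ d ∈ cantorSet, d ∈ cantorBand (n + 1) ∧ e = d - bandCenter c := by
      rcases he with rfl | rfl
      · exact ⟨c, hc, hb, rfl⟩
      · exact ⟨_, cantorSet_reflect_mem n hc hb, cantorBand_reflect_mem hb, by
          rw [reflect_eq hb]; ring⟩
    obtain ⟨d, hdc, hdb, rfl⟩ := hec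
    have hm : bandCenter c = bandCenter d := by rw [bandCenter_eq hb, bandCenter_eq hdb]
    rw [hm] at h1 h2
    have hd1 := cantorSet_subset_unitInterval hdc
    have hd0 := pos_of_mem_cantorBand hdb
    have hle : 1 - d ≤ 1 - r * d := by nlinarith [hr.2]
    have hmem : ((1 - r * d, d) : ℝ × ℝ) ∈ knasterDomain :=
      ⟨⟨by linarith [hd1.2], by nlinarith [hr.1]⟩, hdc⟩
    refine ⟨_, hmem, ?_⟩
    rw [knasterMap_of_ge hmem hle]
    have : (1 - (1 - r * d)) / d = r := by
      rw [sub_sub_cancel, mul_div_cancel_right₀ _ hd0.ne']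
    simp only [this]
    refine Prod.ext ?_ ?_
    · change bandCenter d + (d - bandCenter d) * r = q.1
      linarith
    · change -(|d - bandCenter d| * √(1 - r ^ 2)) = q.2
      linarith

/-- At `y = -1` and `y = 1` the parameter is `0`: these are the top and the bottom, where the
quarter circles with reflected end points meet. -/
theorem KnasterRel.knasterMap_eq {s t : ℝ × ℝ} (hs : s ∈ knasterDomain) (ht : t ∈ knasterDomain)
    (h : KnasterRel s t) : knasterMap s = knasterMap t := by
  obtain ⟨y, c⟩ := s
  obtain ⟨z, d⟩ := t
  obtain ⟨h0, h1⟩ := h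
  simp only at h0 h1
  subst h0
  rcases h1 with rfl | ⟨rfl, rfl⟩ | ⟨rfl, n, h2, rfl⟩
  · rfl
  · have hc := cantorSet_subset_unitInterval hs.2
    rw [knasterMap_of_le (by simp only; linarith [hc.2]),
      knasterMap_of_le (by simp only; linarith [hc.1])]
    have : |(1 - c) - 1 / 2| = |c - 1 / 2| := by
      rw [← abs_neg]
      congr 1
      ring
    simp [upperPoint] at this ⊢
    exact this.symm
  · have hd := cantorBand_reflect_mem h2
    have e : bandCenter (5 / 3 ^ (n + 1) - c) = bandCenter c := by
      rw [bandCenter_eq h2, bandCenter_eq hd]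
    rw [knasterMap_of_ge hs (by simp only; linarith [pos_of_mem_cantorBand h2]),
      knasterMap_of_ge ht (by simp only; linarith [pos_of_mem_cantorBand hd])]
    have : |(5 / 3 ^ (n + 1) - c) - bandCenter c| = |c - bandCenter c| := by
      rw [reflect_eq h2, ← abs_neg]
      congr 1
      ring
    simp only [lowerPoint, e, this]
    simp

theorem lowerPoint_fst_mem {n : ℕ} {c r : ℝ} (h : c ∈ cantorBand (n + 1)) (hr : r ∈ Icc (0 : ℝ) 1) :
    (lowerPoint c r).1 ∈ cantorBand (n + 1) := by
  have := (convex_Icc (2 / 3 ^ (n + 1)) (3 / 3 ^ (n + 1) : ℝ)) (bandCenter_mem h) h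
    (sub_nonneg.2 hr.2) hr.1 (sub_add_cancel 1 r)
  have e : (lowerPoint c r).1 = (1 - r) • bandCenter c + r • c := by
    simp only [lowerPoint, smul_eq_mul]
    ring
  rw [e]
  exact this

/-- An upper and a lower quarter circle meet only in a common end point. -/
theorem eq_of_upper_eq_lower {s t : ℝ × ℝ} (hs : s ∈ knasterDomain) (ht : t ∈ knasterDomain)
    (hs1 : s.1 ≤ 1 - s.2) (ht1 : 1 - t.2 < t.1) (h : knasterMap s = knasterMap t) : s = t := by
  obtain ⟨n, hn⟩ := exists_mem_cantorBand ht.2 (c := t.2) fun h0 => by linarith [ht.1.2]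
  have hr := upper_param_mem hs hs1
  have hq := lower_param_mem ht ht1.le
  rw [knasterMap_of_le hs1, knasterMap_of_ge ht ht1.le] at h
  have hq1 : (1 - t.1) / t.2 ≠ 1 := by
    rw [Ne, div_eq_one_iff_eq (pos_of_mem_cantorBand hn).ne']
    intro
    linarith
  have h2 := congr_arg Prod.snd h
  simp only [upperPoint, lowerPoint] at h2
  have h3 : 0 < |t.2 - bandCenter t.2| := abs_pos.2 (bandCenter_ne ht.2 hn)
  have h4 : 0 < √(1 - ((1 - t.1) / t.2) ^ 2) :=
    Real.sqrt_pos.2 (by nlinarith [hq.1, lt_of_le_of_ne hq.2 hq1])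
  have h5 := mul_pos h3 h4
  have h6 := mul_nonneg (abs_nonneg (s.2 - 1 / 2))
    (Real.sqrt_nonneg (1 - ((s.1 + 1) / (2 - s.2)) ^ 2))
  linarith

theorem knasterRel_of_knasterMap_eq {s t : ℝ × ℝ} (hs : s ∈ knasterDomain)
    (ht : t ∈ knasterDomain) (h : knasterMap s = knasterMap t) : KnasterRel s t := by
  rcases le_or_gt s.1 (1 - s.2) with hs1 | hs1 <;> rcases le_or_gt t.1 (1 - t.2) with ht1 | ht1
  · rw [knasterMap_of_le hs1, knasterMap_of_le ht1] at h
    have h1 := congr_arg Prod.fst h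
    have h2 := congr_arg Prod.snd h
    have hs2 : 2 - s.2 ≠ 0 := by linarith [(cantorSet_subset_unitInterval hs.2).2]
    have ht2 : 2 - t.2 ≠ 0 := by linarith [(cantorSet_subset_unitInterval ht.2).2]
    rcases quarterCircle_inj (sub_ne_zero.2 (ne_half_of_mem_cantorSet hs.2))
      (upper_param_mem hs hs1) (upper_param_mem ht ht1) (add_left_cancel h1) h2 with
      ⟨e, hr⟩ | ⟨e, hr, hr'⟩
    · have e' : t.2 = s.2 := by linarith
      rw [e', div_left_inj' hs2] at hr
      exact ⟨by linarith, Or.inl e'.symm⟩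
    · rw [div_eq_zero_iff, or_iff_left hs2] at hr
      rw [div_eq_zero_iff, or_iff_left ht2] at hr'
      exact ⟨by linarith, Or.inr (Or.inl ⟨by linarith, by linarith⟩)⟩
  · rw [eq_of_upper_eq_lower hs ht hs1 ht1 h]
    exact ⟨rfl, Or.inl rfl⟩
  · rw [eq_of_upper_eq_lower ht hs ht1 hs1 h.symm]
    exact ⟨rfl, Or.inl rfl⟩
  · obtain ⟨n, hn⟩ := exists_mem_cantorBand hs.2 (c := s.2) fun h0 => by linarith [hs.1.2]
    obtain ⟨m, hm⟩ := exists_mem_cantorBand ht.2 (c := t.2) fun h0 => by linarith [ht.1.2]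
    have hr := lower_param_mem hs hs1.le
    have hq := lower_param_mem ht ht1.le
    have hs2 := (pos_of_mem_cantorBand hn).ne'
    have ht2 := (pos_of_mem_cantorBand hm).ne'
    rw [knasterMap_of_ge hs hs1.le, knasterMap_of_ge ht ht1.le] at h
    -- A lower half circle lies over its band, so coinciding lower points belong to one band and
    -- have the same centre.
    have e := cantorBand_unique (lowerPoint_fst_mem hn hr) (h ▸ lowerPoint_fst_mem hm hq)
    rw [← e] at hm
    have hc : bandCenter t.2 = bandCenter s.2 := by rw [bandCenter_eq hm, bandCenter_eq hn]
    have h1 := congr_arg Prod.fst h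
    have h2 := neg_injective (congr_arg Prod.snd h)
    simp only [lowerPoint, hc] at h1 h2
    rcases quarterCircle_inj (bandCenter_ne hs.2 hn) hr hq (add_left_cancel h1) h2 with
      ⟨e, hr⟩ | ⟨e, hr, hr'⟩
    · have e' : t.2 = s.2 := by linarith
      rw [e', div_left_inj' hs2] at hr
      exact ⟨by linarith, Or.inl e'.symm⟩
    · rw [div_eq_zero_iff, or_iff_left hs2] at hr
      rw [div_eq_zero_iff, or_iff_left ht2] at hr'
      refine ⟨by linarith, Or.inr (Or.inr ⟨by linarith, n, hn, ?_⟩)⟩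
      rw [reflect_eq hn]
      linarith

end HalfCircles

/-- Two Hausdorff quotients of a compact space with the same fibres are homeomorphic. -/
theorem nonempty_homeomorph_of_fibers {S Y Z : Type*} [TopologicalSpace S] [CompactSpace S]
    [TopologicalSpace Y] [T2Space Y] [TopologicalSpace Z] [T2Space Z] {f : S → Y} {g : S → Z}
    (hf : Continuous f) (hg : Continuous g) (hfs : Function.Surjective f)
    (hgs : Function.Surjective g) (h : ∀ s t, f s = f t ↔ g s = g t) : Nonempty (Y ≃ₜ Z) := by
  have hq : IsQuotientMap f := hf.isClosedMap.isQuotientMap hf hfs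
  have : CompactSpace Y := hfs.compactSpace hf
  let e : Y → Z := fun y => g (Function.surjInv hfs y)
  have he : ∀ s, e (f s) = g s := fun s => (h _ _).1 (Function.surjInv_eq hfs (f s))
  have hec : Continuous e := hq.continuous_iff.2 (hg.congr fun s => (he s).symm)
  have hb : Function.Bijective e := by
    refine ⟨fun a b hab => ?_, fun z => ?_⟩
    · obtain ⟨s, rfl⟩ := hfs a
      obtain ⟨t, rfl⟩ := hfs b
      rw [he, he] at hab
      exact (h s t).2 hab
    · obtain ⟨s, rfl⟩ := hgs z
      exact ⟨f s, he s⟩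
  exact ⟨Continuous.homeoOfEquivCompactToT2 (f := Equiv.ofBijective e hb) hec⟩

/-! ### Comparison of the two quotients, and the theorem -/

theorem nonempty_homeomorph_knasterContinuum : Nonempty (KContinuum 2 ≃ₜ knasterContinuum) := by
  have : CompactSpace knasterDomain := isCompact_iff_compactSpace.1 isCompact_knasterDomain
  have hmem : ∀ s : knasterDomain, ∃ w : KContinuum 2, KContinuum.coord w = knasterOrbit s :=
    fun s => KContinuum.mem_range_coord_two (fun k => (knasterOrbit_mem s.2 k).1)
      fun k => (knasterOrbit_mem s.2 k).2
  choose f hf using hmem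
  have hfc : Continuous f := by
    rw [KContinuum.isClosedEmbedding_coord.isEmbedding.continuous_iff]
    exact (continuous_knasterOrbit.comp continuous_subtype_val).congr fun s => (hf s).symm
  have hfs : Function.Surjective f := by
    rw [← range_eq_univ]
    refine KContinuum.eq_univ_of_coord le_rfl (isCompact_range hfc).isClosed fun w n => ?_
    obtain ⟨s, hs, h⟩ := exists_knasterOrbit_eq (fun k => KContinuum.coord_mem_Icc w k)
      (fun k => KContinuum.coord_two w k) n
    exact ⟨f ⟨s, hs⟩, mem_range_self _, by rw [hf]; exact h n le_rfl⟩
  refine nonempty_homeomorph_of_fibers (S := knasterDomain) hfc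
    (g := fun s => ⟨knasterMap s, knasterMap_mem s.2⟩)
    (continuousOn_knasterMap.domRestrict.subtype_mk _) hfs ?_ fun s t => ?_
  · rintro ⟨q, hq⟩
    obtain ⟨s, hs, h⟩ := exists_knasterMap_eq hq
    exact ⟨⟨s, hs⟩, Subtype.ext h⟩
  · rw [← KContinuum.coord_injective.eq_iff, hf, hf, Subtype.mk.injEq]
    exact ⟨fun h => (knasterRel_of_knasterOrbit_eq s.2 t.2 h).knasterMap_eq s.2 t.2,
      fun h => (knasterRel_of_knasterMap_eq s.2 t.2 h).knasterOrbit_eq s.2⟩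

theorem theorem4p4 :
    (∀ p : ℕ∞, 2 ≤ p →
      IsContinuum (KContinuum p) ∧
      ∀ (X : Type u) [MetricSpace X] [ProperSpace X] [SimplyConnectedSpace X] [NoncompactSpace X],
        IsGeodesicSpace X → IsFiniteDimensionalSpace X →
          ∃ (A : Type u) (F : HigsonCompactification X → (A → KContinuum p)),
            IsEmbedding F ∧ IsEssentialSubset (range F)) ∧
    Nonempty (KContinuum 2 ≃ₜ knasterContinuum) := by
  refine ⟨fun p hp => ⟨KContinuum.isContinuum hp, fun X _ _ _ _ _ _ => ?_⟩,
    nonempty_homeomorph_knasterContinuum⟩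
  refine HigsonCompactification.exists_essential_embedding hp X ?_
  -- In a proper space the cobounded filter is the cocompact one, which is nontrivial by
  -- non-compactness.
  rw [Metric.cobounded_eq_cocompact]
  infer_instance
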